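/- A tournament is an orientation of a finite complete graph. For a finite loopless digraph $D$ and a vertex $v$, write $\mathrm{ex}_D(v)=d^+_D(v)-d^-_D(v)$ and let $$\mathrm{ex}(D)=\sum_{v\in V(D)}\max\{\mathrm{ex}_D(v),0\}$$ be the excess of $D$. A path decomposition of $D$ is a set of directed paths of $D$, each with at least one edge, whose edge sets partition $E(D)$. The path number $\mathrm{pn}(D)$ is the minimum number of paths in a path decomposition of $D$, and a perfect decomposition of $D$ is a path decomposition of $D$ consisting of exactly $\mathrm{ex}(D)$ paths. **Theorem.** (a) For every real $\gamma>0$ there is $n_0=n_0(\gamma)\in\mathbb{N}$ such that every tournament $T$ on $n\ge n_0$ vertices with $\mathrm{ex}(T)\ge 8n^{17/9+\gamma}$ has a perfect decomposition. (b) There is $n_0\in\mathbb{N}$ such that every tournament $T$ on $n>n_0$ vertices with $n$ even and $\mathrm{ex}(T)\ge n^{2-1/18}$ satisfies $\mathrm{pn}(T)=\mathrm{ex}(T)$. -/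

import Mathlib

universe u

namespace PathDecomp

variable {V : Type u}

/-- The set of directed edges of a digraph. -/
def edgeSet (D : Digraph V) : Set (V × V) := {e | D.Adj e.1 e.2}

/-- A tournament: an orientation of the complete graph, i.e. no loops, and between any two
distinct vertices exactly one of the two possible directed edges. -/
def IsTournament (T : Digraph V) : Prop :=
  (∀ v, ¬ T.Adj v v) ∧ ∀ v w, v ≠ w → Xor (T.Adj v w) (T.Adj w v)

/-- Outdegree. -/
noncomputable def outdeg (D : Digraph V) (v : V) : ℕ := {w | D.Adj v w}.ncard

/-- Indegree. -/
noncomputable def indeg (D : Digraph V) (v : V) : ℕ := {w | D.Adj w v}.ncard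

/-- The excess `d⁺(v) - d⁻(v)` at a vertex, an integer. -/
noncomputable def excessAt (D : Digraph V) (v : V) : ℤ := (outdeg D v : ℤ) - (indeg D v : ℤ)

/-- The excess of a digraph: the sum over all vertices of `max {d⁺(v) - d⁻(v), 0}`. -/
noncomputable def excess [Fintype V] (D : Digraph V) : ℕ := ∑ v, (excessAt D v).toNat

/-- A directed path with at least one edge, given by its sequence of (distinct) vertices;
consecutive vertices are joined by an edge directed forwards. -/
def IsDipath (D : Digraph V) (l : List V) : Prop :=
  2 ≤ l.length ∧ l.Nodup ∧ l.IsChain D.Adj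

/-- The edges of the path with vertex sequence `l`: the pairs of consecutive entries of `l`. -/
def pathEdges (l : List V) : Set (V × V) := {e | [e.1, e.2] <:+: l}

/-- A path decomposition of `D`: a set of directed paths of `D` whose edge sets partition the
edge set of `D`. -/
def IsPathDecomposition (D : Digraph V) (P : Finset (List V)) : Prop :=
  (∀ l ∈ P, IsDipath D l) ∧ (P : Set (List V)).PairwiseDisjoint pathEdges ∧
    ⋃ l ∈ P, pathEdges l = edgeSet D

/-- The path number of `D`: the minimum number of paths in a path decomposition of `D`. -/
noncomputable def pathNumber (D : Digraph V) : ℕ :=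
  sInf {k | ∃ P : Finset (List V), IsPathDecomposition D P ∧ P.card = k}

/-- A perfect decomposition of `D`: a path decomposition of `D` into exactly `ex(D)` paths. -/
def HasPerfectDecomposition [Fintype V] (D : Digraph V) : Prop :=
  ∃ P : Finset (List V), IsPathDecomposition D P ∧ P.card = excess D

/-- The edges of a one-edge path. -/
lemma pathEdges_pair (a b : V) : pathEdges [a, b] = {(a, b)} := by
  ext ⟨x, y⟩
  simp only [pathEdges, Set.mem_ofPred_eq, Set.mem_singleton_iff, Prod.mk.injEq]
  constructor
  · intro h
    have := h.eq_of_length (by simp)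
    simpa using this
  · rintro ⟨rfl, rfl⟩
    exact List.infix_rfl

/-- The minimum defining `pathNumber` is attained: a finite digraph without loops has a path
decomposition (into single edges). -/
lemma exists_isPathDecomposition_card_eq_pathNumber [Fintype V] (D : Digraph V)
    (hD : ∀ v, ¬ D.Adj v v) :
    ∃ P : Finset (List V), IsPathDecomposition D P ∧ P.card = pathNumber D := by
  classical
  refine Nat.sInf_mem (s := {k | ∃ P : Finset (List V), IsPathDecomposition D P ∧ P.card = k})
    ⟨_, (Finset.univ.filter fun e : V × V => D.Adj e.1 e.2).image fun e => [e.1, e.2],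
      ⟨?_, ?_, ?_⟩, rfl⟩
  · intro l hl
    obtain ⟨⟨a, b⟩, he, rfl⟩ := Finset.mem_image.1 hl
    have hab : D.Adj a b := by simpa using he
    have hne : a ≠ b := by
      rintro rfl
      exact hD _ hab
    simp [IsDipath, hne, hab]
  · intro l hl l' hl' hne
    obtain ⟨⟨a, b⟩, -, rfl⟩ := Finset.mem_image.1 hl
    obtain ⟨⟨c, d⟩, -, rfl⟩ := Finset.mem_image.1 hl'
    simp only [Function.onFun, pathEdges_pair, Set.disjoint_singleton]
    rintro h
    apply hne
    simp_all
  · ext ⟨x, y⟩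
    simp only [Set.mem_iUnion, edgeSet, Set.mem_ofPred_eq]
    constructor
    · rintro ⟨l, hl, h⟩
      obtain ⟨⟨a, b⟩, he, rfl⟩ := Finset.mem_image.1 hl
      rw [pathEdges_pair] at h
      obtain ⟨rfl, rfl⟩ : x = a ∧ y = b := by simpa using h
      simpa using he
    · intro h
      exact ⟨[x, y], Finset.mem_image.2 ⟨(x, y), by simpa using h, rfl⟩, by
        rw [pathEdges_pair]; rfl⟩

end PathDecomp

/-! ### Families of paths: arcs, starts, ends and excess. -/

namespace PathDecomp

open Finset

variable {V : Type u}

/-! In any path decomposition, starts minus ends at v equals the excess of v. Hence a decomposition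
is perfect as soon as no vertex is both a start and an end (`hasPerfectDecomposition_of_family`).
Such conflicts are removed with a reserve of absorbers.

Absorption. Let S and R be the vertices of excess at least t and at most -t; a large excess of T
makes both large. An absorber at x is a path αxβ from S to R. If Ax and xB are paths, then Ax, xB,
αxβ can be respliced into Axβ and αxB: same arcs, one start and one end fewer at x, no other start
or end changed. Each end of a path is extended at most once, since it then lies in S or R. So it
suffices that absorbers at x meet only in x and outnumber the conflicts at x plus two path lengths
(`exists_family_of_absorbers`).

Absorbers are found greedily. Outside S the outdegree exceeds the indegree by less than t, so a
backward search from x roughly halves the unreached set at each step and soon meets S, even with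
some arcs and vertices forbidden (`exists_connector`, `exists_isAbsorberSystem`).

The other arcs must be decomposed into short paths with few conflicts. Colour the vertices by `ZMod
p` and split the arcs by colour difference. For a nonzero difference, cutting the cycle of colours
once leaves an acyclic set, which decomposes without conflicts into paths on at most p vertices. If
all colour counts are within τ of their means, the classes are nearly balanced at v, up to the sign
of its excess, leaving O(pτ + n/p) conflicts (`exists_family_of_colouring`).

With τ near √n and p near n^(1/4), about n^(3/4) absorbers per vertex suffice. Their vertices can be
spread with load near n^(7/8), below t of order n^(8/9), and excess of order nt makes S and R large
enough. -/

/-- The list of consecutive pairs of a list. -/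
def arcs : List V → List (V × V)
  | [] => []
  | [_] => []
  | a :: b :: l => (a, b) :: arcs (b :: l)

@[simp] lemma arcs_nil : arcs ([] : List V) = [] := rfl
@[simp] lemma arcs_singleton (a : V) : arcs [a] = [] := rfl
@[simp] lemma arcs_cons_cons (a b : V) (l : List V) :
    arcs (a :: b :: l) = (a, b) :: arcs (b :: l) := rfl

/-- This is what allows paths through x to exchange their tails without changing the total multiset
of arcs. -/
lemma arcs_append (α β : List V) (x : V) :
    arcs (α ++ x :: β) = arcs (α ++ [x]) ++ arcs (x :: β) := by
  induction α with
  | nil => simp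
  | cons a α ih =>
    cases α with
    | nil => simp
    | cons b α => simpa using ih

lemma mem_arcs_iff {a b : V} {l : List V} : (a, b) ∈ arcs l ↔ [a, b] <:+: l := by
  induction l with
  | nil => simp
  | cons c l ih =>
    cases l with
    | nil =>
      simp only [arcs_singleton, List.not_mem_nil, false_iff]
      intro h
      simpa using h.length_le
    | cons d l =>
      rw [arcs_cons_cons, List.mem_cons, ih, List.infix_cons_iff (l₂ := d :: l)]
      simp

lemma pathEdges_eq (l : List V) : pathEdges l = {e | e ∈ arcs l} := by
  ext ⟨a, b⟩
  exact mem_arcs_iff.symm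

lemma isChain_iff_arcs {R : V → V → Prop} {l : List V} :
    l.IsChain R ↔ ∀ e ∈ arcs l, R e.1 e.2 := by
  induction l with
  | nil => simp
  | cons c l ih =>
    cases l with
    | nil => simp
    | cons d l => simp [ih]

lemma mem_of_mem_arcs {e : V × V} {l : List V} (h : e ∈ arcs l) : e.1 ∈ l ∧ e.2 ∈ l := by
  have h' : [e.1, e.2] <:+: l := mem_arcs_iff.1 h
  exact ⟨h'.subset (by simp), h'.subset (by simp)⟩

lemma nodup_arcs {l : List V} (h : l.Nodup) : (arcs l).Nodup := by
  induction l with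
  | nil => simp
  | cons c l ih =>
    cases l with
    | nil => simp
    | cons d l =>
      rw [arcs_cons_cons, List.nodup_cons]
      exact ⟨fun hm => (List.nodup_cons.1 h).1 (mem_of_mem_arcs hm).1, ih (List.nodup_cons.1 h).2⟩

lemma arcs_ne_nil {l : List V} (h : 2 ≤ l.length) : arcs l ≠ [] := by
  match l, h with
  | a :: b :: l, _ => simp

/-- All arcs of a family of paths. -/
def arcsOf (P : Multiset (List V)) : Multiset (V × V) := (P.map fun l => (arcs l : Multiset (V × V))).sum

@[simp] lemma arcsOf_zero : arcsOf (0 : Multiset (List V)) = 0 := rfl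
@[simp] lemma arcsOf_cons (l : List V) (P : Multiset (List V)) :
    arcsOf (l ::ₘ P) = (arcs l : Multiset (V × V)) + arcsOf P := by simp [arcsOf]
@[simp] lemma arcsOf_add (P Q : Multiset (List V)) : arcsOf (P + Q) = arcsOf P + arcsOf Q := by
  simp [arcsOf]
lemma mem_arcsOf {e : V × V} {P : Multiset (List V)} : e ∈ arcsOf P ↔ ∃ l ∈ P, e ∈ arcs l := by
  induction P using Multiset.induction_on with
  | empty => simp
  | cons l P ih => simp [ih]

lemma head?_append_cons (A β : List V) (x : V) :
    (A ++ x :: β).head? = (A ++ [x]).head? := by cases A <;> simp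

lemma getLast?_append_cons (A β : List V) (x : V) :
    (A ++ x :: β).getLast? = (x :: β).getLast? := by
  rw [List.getLast?_append]; cases h : (x :: β).getLast? <;> simp_all

lemma nodup_of_nodup_arcsOf (P : Multiset (List V)) (hP : ∀ l ∈ P, 2 ≤ l.length)
    (h : (arcsOf P).Nodup) :
    P.Nodup ∧ ∀ l ∈ P, ∀ l' ∈ P, l ≠ l' → ∀ e ∈ arcs l, e ∉ arcs l' := by
  induction P using Multiset.induction_on with
  | empty => simp
  | cons l P ih =>
    rw [arcsOf_cons, Multiset.nodup_add] at h
    obtain ⟨h1, h2⟩ := ih (fun l hl => hP l (Multiset.mem_cons_of_mem hl)) h.2.1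
    have h3 : ∀ l' ∈ P, ∀ e ∈ arcs l, e ∉ arcs l' := fun l' hl' e he he' =>
      Multiset.disjoint_left.1 h.2.2 (by simpa using he) (mem_arcsOf.2 ⟨l', hl', he'⟩)
    refine ⟨Multiset.nodup_cons.2 ⟨fun hl => ?_, h1⟩, ?_⟩
    · obtain ⟨e, he⟩ := List.exists_mem_of_ne_nil _ (arcs_ne_nil (hP l (by simp)))
      exact h3 l hl e he he
    · intro a ha b hb hab e he he'
      rcases Multiset.mem_cons.1 ha with rfl | ha' <;> rcases Multiset.mem_cons.1 hb with rfl | hb'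
      · exact hab rfl
      · exact h3 b hb' e he he'
      · exact h3 a ha' e he' he
      · exact h2 a ha' b hb' hab e he he'

section Families

variable [DecidableEq V]

lemma countP_fst_arcs (l : List V) (v : V) :
    (arcs l).countP (fun e => e.1 = v) + (if l.getLast? = some v then 1 else 0) = l.count v := by
  induction l with
  | nil => simp
  | cons c l ih =>
    cases l with
    | nil => simp [List.count_cons]
    | cons d l =>
      rw [arcs_cons_cons, List.countP_cons, List.count_cons, ← ih, List.getLast?_cons_cons]
      simp only [decide_eq_true_eq, beq_iff_eq]
      omega

lemma countP_snd_arcs (l : List V) (v : V) :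
    (arcs l).countP (fun e => e.2 = v) + (if l.head? = some v then 1 else 0) = l.count v := by
  induction l with
  | nil => simp
  | cons c l ih =>
    cases l with
    | nil => simp [List.count_cons]
    | cons d l =>
      rw [arcs_cons_cons, List.countP_cons, List.count_cons, ← ih]
      simp only [decide_eq_true_eq, beq_iff_eq, List.head?_cons, Option.some.injEq]

/-- The number of members of a family starting at a vertex. -/
def startsAt (P : Multiset (List V)) (v : V) : ℕ := P.countP (fun l => l.head? = some v)

/-- The number of members of a family ending at a vertex. -/
def endsAt (P : Multiset (List V)) (v : V) : ℕ := P.countP (fun l => l.getLast? = some v)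

@[simp] lemma startsAt_zero (v : V) : startsAt (0 : Multiset (List V)) v = 0 := rfl
@[simp] lemma endsAt_zero (v : V) : endsAt (0 : Multiset (List V)) v = 0 := rfl
@[simp] lemma startsAt_cons (l : List V) (P : Multiset (List V)) (v : V) :
    startsAt (l ::ₘ P) v = startsAt P v + if l.head? = some v then 1 else 0 := by
  simp [startsAt, Multiset.countP_cons]
@[simp] lemma endsAt_cons (l : List V) (P : Multiset (List V)) (v : V) :
    endsAt (l ::ₘ P) v = endsAt P v + if l.getLast? = some v then 1 else 0 := by
  simp [endsAt, Multiset.countP_cons]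
@[simp] lemma startsAt_add (P Q : Multiset (List V)) (v : V) :
    startsAt (P + Q) v = startsAt P v + startsAt Q v := by simp [startsAt]
@[simp] lemma endsAt_add (P Q : Multiset (List V)) (v : V) :
    endsAt (P + Q) v = endsAt P v + endsAt Q v := by simp [endsAt]

lemma startsAt_pos {P : Multiset (List V)} {v : V} :
    0 < startsAt P v ↔ ∃ l ∈ P, l.head? = some v := by simp [startsAt, Multiset.countP_pos]
lemma endsAt_pos {P : Multiset (List V)} {v : V} :
    0 < endsAt P v ↔ ∃ l ∈ P, l.getLast? = some v := by simp [endsAt, Multiset.countP_pos]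

/-- The number of arcs of a multiset leaving a vertex. -/
def outCount (E : Multiset (V × V)) (v : V) : ℕ := E.countP (fun e => e.1 = v)

/-- The number of arcs of a multiset entering a vertex. -/
def inCount (E : Multiset (V × V)) (v : V) : ℕ := E.countP (fun e => e.2 = v)

@[simp] lemma outCount_add (E F : Multiset (V × V)) (v : V) :
    outCount (E + F) v = outCount E v + outCount F v := by simp [outCount]
@[simp] lemma inCount_add (E F : Multiset (V × V)) (v : V) :
    inCount (E + F) v = inCount E v + inCount F v := by simp [inCount]

/-- A path visiting v uses one arc into v and one out of v, except at its own first or last vertex.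
-/
lemma outCount_arcsOf_add_endsAt (P : Multiset (List V)) (v : V) :
    outCount (arcsOf P) v + endsAt P v = inCount (arcsOf P) v + startsAt P v := by
  induction P using Multiset.induction_on with
  | empty => simp [outCount, inCount]
  | cons l P ih =>
    have h1 := countP_fst_arcs l v
    have h2 := countP_snd_arcs l v
    have h3 : outCount (arcs l : Multiset (V × V)) v = (arcs l).countP (fun e => e.1 = v) := by
      simp [outCount]
    have h4 : inCount (arcs l : Multiset (V × V)) v = (arcs l).countP (fun e => e.2 = v) := by
      simp [inCount]
    rw [arcsOf_cons, outCount_add, inCount_add, endsAt_cons, startsAt_cons, h3, h4]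
    omega

lemma outCount_arcsOf_le (P : Multiset (List V)) (hP : ∀ l ∈ P, l.Nodup) (v : V) :
    outCount (arcsOf P) v ≤ P.countP (fun l => v ∈ l) ∧
    inCount (arcsOf P) v ≤ P.countP (fun l => v ∈ l) := by
  induction P using Multiset.induction_on with
  | empty => simp [outCount, inCount]
  | cons l P ih =>
    have h1 := countP_fst_arcs l v
    have h2 := countP_snd_arcs l v
    have h3 : outCount (arcs l : Multiset (V × V)) v = (arcs l).countP (fun e => e.1 = v) := by
      simp [outCount]
    have h4 : inCount (arcs l : Multiset (V × V)) v = (arcs l).countP (fun e => e.2 = v) := by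
      simp [inCount]
    have h5 : l.count v ≤ if v ∈ l then 1 else 0 := by
      split_ifs with h
      · exact List.nodup_iff_count_le_one.1 (hP l (by simp)) v
      · simp [List.count_eq_zero_of_not_mem h]
    have := ih fun l hl => hP l (Multiset.mem_cons_of_mem hl)
    rw [arcsOf_cons, outCount_add, inCount_add, Multiset.countP_cons, h3, h4]
    omega

lemma card_eq_sum_startsAt [Fintype V] (P : Multiset (List V)) (hP : ∀ l ∈ P, 2 ≤ l.length) :
    P.card = ∑ v, startsAt P v := by
  induction P using Multiset.induction_on with
  | empty => simp
  | cons l P ih =>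
    have := ih fun l hl => hP l (Multiset.mem_cons_of_mem hl)
    have h2 : 2 ≤ l.length := hP l (by simp)
    match l, h2 with
    | a :: l, _ => simp [this, Finset.sum_add_distrib]

end Families

section Digraph

open scoped Classical in
/-- The arcs of a finite digraph as a finset. -/
noncomputable def arcFinset [Fintype V] (D : Digraph V) : Finset (V × V) :=
  Finset.univ.filter fun e => D.Adj e.1 e.2

@[simp] lemma mem_arcFinset [Fintype V] {D : Digraph V} {e : V × V} :
    e ∈ arcFinset D ↔ D.Adj e.1 e.2 := by simp [arcFinset]

variable [Fintype V] [DecidableEq V]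

lemma outCount_finset (E : Finset (V × V)) (v : V) :
    outCount E.val v = #{w | (v, w) ∈ E} := by
  rw [outCount, Multiset.countP_eq_card_filter, ← Finset.filter_val, Finset.card_val]
  refine Finset.card_bij' (fun e _ => e.2) (fun w _ => (v, w)) ?_ ?_ ?_ ?_
  · rintro ⟨a, b⟩ h
    simp only [Finset.mem_filter] at h ⊢
    obtain ⟨h, rfl⟩ := h
    exact ⟨Finset.mem_univ _, h⟩
  · intro w h
    simpa using h
  · rintro ⟨a, b⟩ h
    simp only [Finset.mem_filter] at h
    simp [h.2]
  · simp

lemma inCount_finset (E : Finset (V × V)) (v : V) :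
    inCount E.val v = #{w | (w, v) ∈ E} := by
  rw [inCount, Multiset.countP_eq_card_filter, ← Finset.filter_val, Finset.card_val]
  refine Finset.card_bij' (fun e _ => e.1) (fun w _ => (w, v)) ?_ ?_ ?_ ?_
  · rintro ⟨a, b⟩ h
    simp only [Finset.mem_filter] at h ⊢
    obtain ⟨h, rfl⟩ := h
    exact ⟨Finset.mem_univ _, h⟩
  · intro w h
    simpa using h
  · rintro ⟨a, b⟩ h
    simp only [Finset.mem_filter] at h
    simp [h.2]
  · simp

lemma outdeg_eq (D : Digraph V) (v : V) : outdeg D v = outCount (arcFinset D).val v := by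
  classical
  rw [outCount_finset, outdeg, Set.ncard_eq_toFinset_card']
  congr 1
  ext; simp

lemma indeg_eq (D : Digraph V) (v : V) : indeg D v = inCount (arcFinset D).val v := by
  classical
  rw [inCount_finset, indeg, Set.ncard_eq_toFinset_card']
  congr 1
  ext; simp

lemma excessAt_eq (D : Digraph V) (P : Multiset (List V)) (hE : arcsOf P = (arcFinset D).val)
    (v : V) : excessAt D v = (startsAt P v : ℤ) - endsAt P v := by
  have := outCount_arcsOf_add_endsAt P v
  rw [excessAt, outdeg_eq, indeg_eq, ← hE]
  omega

/-- A family of paths partitioning the arcs such that no vertex is both a start and an end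
is a perfect decomposition. -/
lemma hasPerfectDecomposition_of_family (D : Digraph V) (P : Multiset (List V))
    (hP : ∀ l ∈ P, l.Nodup ∧ 2 ≤ l.length) (hE : arcsOf P = (arcFinset D).val)
    (h0 : ∀ v, startsAt P v = 0 ∨ endsAt P v = 0) : HasPerfectDecomposition D := by
  have hnd := nodup_of_nodup_arcsOf P (fun l hl => (hP l hl).2) (hE ▸ (arcFinset D).nodup)
  have hmem : ∀ e : V × V, D.Adj e.1 e.2 ↔ ∃ l ∈ P, e ∈ arcs l := fun e => by
    rw [← mem_arcsOf, hE, Finset.mem_val, mem_arcFinset]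
  refine ⟨⟨P, hnd.1⟩, ⟨fun l hl => ⟨(hP l hl).2, (hP l hl).1, ?_⟩, ?_, ?_⟩, ?_⟩
  · exact isChain_iff_arcs.2 fun e he => (hmem e).2 ⟨l, hl, he⟩
  · intro l hl l' hl' hne
    rw [Function.onFun, Set.disjoint_left, pathEdges_eq, pathEdges_eq]
    exact fun e he => hnd.2 l hl l' hl' hne e he
  · ext e
    simp [pathEdges_eq, edgeSet, hmem]
  · rw [Finset.card_mk, card_eq_sum_startsAt P fun l hl => (hP l hl).2, excess]
    refine Finset.sum_congr rfl fun v _ => ?_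
    rw [excessAt_eq D P hE]
    rcases h0 v with h | h <;> omega

lemma arcsOf_eq_of_isPathDecomposition {D : Digraph V} {P : Finset (List V)}
    (h : IsPathDecomposition D P) : arcsOf P.val = (arcFinset D).val := by
  have hnd : (arcsOf P.val).Nodup := by
    have key : ∀ Q : Finset (List V), Q ⊆ P → (arcsOf Q.val).Nodup := by
      intro Q
      induction Q using Finset.induction_on with
      | empty => simp
      | insert l Q hl ih =>
        intro hQ
        rw [Finset.insert_val_of_notMem hl, arcsOf_cons, Multiset.nodup_add]
        refine ⟨by simpa using nodup_arcs (h.1 l (hQ (by simp))).2.1,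
          ih fun x hx => hQ (Finset.mem_insert_of_mem hx), ?_⟩
        rw [Multiset.disjoint_left]
        intro e he he'
        obtain ⟨l', hl', he'⟩ := mem_arcsOf.1 he'
        have hne : l ≠ l' := fun hll => hl (hll ▸ hl')
        have := h.2.1 (hQ (by simp)) (hQ (Finset.mem_insert_of_mem hl')) hne
        rw [Function.onFun, Set.disjoint_left, pathEdges_eq, pathEdges_eq] at this
        exact this (by simpa using he) he'
    exact key P subset_rfl
  refine (Multiset.Nodup.ext hnd (arcFinset D).nodup).2 fun e => ?_
  have h3 := Set.ext_iff.1 h.2.2 e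
  rw [mem_arcsOf, Finset.mem_val, mem_arcFinset]
  simpa [pathEdges_eq, edgeSet] using h3

lemma excess_le_card {D : Digraph V} {P : Finset (List V)} (h : IsPathDecomposition D P) :
    excess D ≤ P.card := by
  rw [Finset.card_def, card_eq_sum_startsAt P.val fun l hl => (h.1 l hl).1, excess]
  refine Finset.sum_le_sum fun v _ => ?_
  rw [excessAt_eq D _ (arcsOf_eq_of_isPathDecomposition h)]
  omega

lemma pathNumber_eq_excess {D : Digraph V} (hD : ∀ v, ¬ D.Adj v v)
    (h : HasPerfectDecomposition D) : pathNumber D = excess D := by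
  obtain ⟨P, hP, hc⟩ := h
  obtain ⟨Q, hQ, hQc⟩ := exists_isPathDecomposition_card_eq_pathNumber D hD
  refine le_antisymm ?_ (hQc ▸ excess_le_card hQ)
  exact Nat.sInf_le ⟨P, hP, hc⟩

end Digraph

/-! ### Conflict-free decomposition of acyclic arc sets. -/

section Acyclic

variable [DecidableEq V]

lemma arcsOf_pairs (F : Finset (V × V)) : arcsOf (F.val.map fun e => [e.1, e.2]) = F.val := by
  induction F using Finset.induction_on with
  | empty => simp
  | insert e F he ih =>
    rw [Finset.insert_val_of_notMem he, Multiset.map_cons, arcsOf_cons, ih]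
    simp [Multiset.singleton_add]

lemma startsAt_pairs (E : Multiset (V × V)) (v : V) :
    startsAt (E.map fun e => [e.1, e.2]) v = outCount E v := by
  rw [startsAt, outCount, Multiset.countP_map, Multiset.countP_eq_card_filter]
  simp

lemma endsAt_pairs (E : Multiset (V × V)) (v : V) :
    endsAt (E.map fun e => [e.1, e.2]) v = inCount E v := by
  rw [endsAt, inCount, Multiset.countP_map, Multiset.countP_eq_card_filter]
  simp

/-- An acyclic arc set decomposes into paths so that no vertex is both a start and an end. -/
lemma exists_family_of_rank (E : Finset (V × V)) (ρ : V → ℕ) (hρ : ∀ e ∈ E, ρ e.1 < ρ e.2) :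
    ∃ P : Multiset (List V), arcsOf P = E.val ∧
      (∀ l ∈ P, 2 ≤ l.length ∧ l.Pairwise (fun a b => ρ a < ρ b)) ∧
      ∀ v, startsAt P v = 0 ∨ endsAt P v = 0 := by
  let good (P : Multiset (List V)) : Prop := arcsOf P = E.val ∧
      (∀ l ∈ P, 2 ≤ l.length ∧ l.Pairwise (fun a b => ρ a < ρ b))
  -- A family with the fewest paths works: a path ending at v and one starting at v could be joined,
  -- and ranks still increase along the result.
  have hex : ∃ m, ∃ P, good P ∧ P.card = m := by
    refine ⟨_, E.val.map fun e => [e.1, e.2], ⟨arcsOf_pairs E, ?_⟩, rfl⟩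
    intro l hl
    obtain ⟨e, he, rfl⟩ := Multiset.mem_map.1 hl
    simpa using hρ e he
  classical
  obtain ⟨P, hP, hc⟩ := Nat.find_spec hex
  refine ⟨P, hP.1, hP.2, fun v => ?_⟩
  by_contra! hv
  obtain ⟨B, hB, hBv⟩ := startsAt_pos.1 (Nat.pos_of_ne_zero hv.1)
  obtain ⟨A, hA, hAv⟩ := endsAt_pos.1 (Nat.pos_of_ne_zero hv.2)
  obtain ⟨A0, rfl⟩ := List.getLast?_eq_some_iff.1 hAv
  obtain ⟨B0, rfl⟩ := List.head?_eq_some_iff.1 hBv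
  have hne : v :: B0 ≠ A0 ++ [v] := by
    intro h
    have h1 := (hP.2 _ hA).1
    have h2 := (hP.2 _ hA).2
    cases A0 with
    | nil => simp at h1
    | cons a A0 =>
      simp only [List.cons_append, List.cons.injEq] at h
      obtain ⟨rfl, -⟩ := h
      simp only [List.cons_append, List.pairwise_cons, List.mem_append, List.mem_singleton] at h2
      exact lt_irrefl _ (h2.1 v (Or.inr rfl))
  obtain ⟨P1, rfl⟩ := Multiset.exists_cons_of_mem hA
  obtain ⟨P2, rfl⟩ := Multiset.exists_cons_of_mem ((Multiset.mem_cons.1 hB).resolve_left hne)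
  have hlt : Multiset.card ((A0 ++ v :: B0) ::ₘ P2) < Nat.find hex := by
    rw [← hc]; simp
  refine Nat.find_min hex hlt ⟨_, ⟨?_, ?_⟩, rfl⟩
  · rw [← hP.1, arcsOf_cons, arcsOf_cons, arcsOf_cons, arcs_append, ← Multiset.coe_add, add_assoc]
  · intro l hl
    rcases Multiset.mem_cons.1 hl with rfl | hl
    · obtain ⟨ha1, ha2⟩ := hP.2 _ hA
      obtain ⟨hb1, hb2⟩ := hP.2 _ hB
      refine ⟨by simp at ha1 hb1 ⊢; omega, ?_⟩
      rw [List.pairwise_append] at ha2 ⊢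
      refine ⟨ha2.1, hb2, fun a ha b hb => ?_⟩
      have h1 := ha2.2.2 a ha v (by simp)
      rcases List.mem_cons.1 hb with rfl | hb
      · exact h1
      · exact h1.trans ((List.pairwise_cons.1 hb2).1 b hb)
    · exact hP.2 l (by simp [hl])

end Acyclic

end PathDecomp

/-! ### Absorption. -/

namespace PathDecomp

open Finset

variable {V : Type u} [DecidableEq V]

/-- The family of paths given by a set of absorbers: the triple `(x, α, β)` stands for the path
`α ++ x :: β` with centre `x`. -/
def absorberPaths (𝒜 : Finset (V × List V × List V)) : Multiset (List V) :=
  𝒜.val.map fun p => p.2.1 ++ p.1 :: p.2.2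

lemma absorberPaths_insert {𝒜 : Finset (V × List V × List V)} {p : V × List V × List V}
    (hp : p ∉ 𝒜) : absorberPaths (insert p 𝒜) = (p.2.1 ++ p.1 :: p.2.2) ::ₘ absorberPaths 𝒜 := by
  rw [absorberPaths, Finset.insert_val_of_notMem hp, Multiset.map_cons, absorberPaths]

/-- A triple `(x, α, β)` is an absorber from `S` to `R` if `α ++ x :: β` is a path from `S` to `R`
and its first (last) part is trivial exactly if its centre lies in `S` (in `R`). -/
structure IsAbsorber (S R : Finset V) (L : ℕ) (p : V × List V × List V) : Prop where
  nodup : (p.2.1 ++ p.1 :: p.2.2).Nodup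
  fst_nil : p.1 ∈ S → p.2.1 = []
  fst_head : p.1 ∉ S → ∃ a ∈ S, p.2.1.head? = some a
  snd_nil : p.1 ∈ R → p.2.2 = []
  snd_last : p.1 ∉ R → ∃ b ∈ R, p.2.2.getLast? = some b
  fst_length : p.2.1.length ≤ L
  snd_length : p.2.2.length ≤ L

namespace IsAbsorber

variable {S R : Finset V} {L : ℕ} {p : V × List V × List V}

lemma head_mem (h : IsAbsorber S R L p) :
    ∃ a ∈ S, (p.2.1 ++ p.1 :: p.2.2).head? = some a := by
  by_cases hp : p.1 ∈ S
  · exact ⟨_, hp, by simp [h.fst_nil hp]⟩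
  · obtain ⟨a, ha, ha'⟩ := h.fst_head hp
    exact ⟨a, ha, by simp [List.head?_append, ha']⟩

lemma last_mem (h : IsAbsorber S R L p) :
    ∃ a ∈ R, (p.2.1 ++ p.1 :: p.2.2).getLast? = some a := by
  rw [getLast?_append_cons]
  by_cases hp : p.1 ∈ R
  · exact ⟨_, hp, by simp [h.snd_nil hp]⟩
  · obtain ⟨a, ha, ha'⟩ := h.snd_last hp
    exact ⟨a, ha, by simp [List.getLast?_cons, ha']⟩

lemma two_le_length (h : IsAbsorber S R L p) (hSR : Disjoint S R) :
    2 ≤ (p.2.1 ++ p.1 :: p.2.2).length := by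
  by_contra! hlt
  have h1 : p.2.1 = [] := List.length_eq_zero_iff.1 (by simp at hlt; omega)
  have h2 : p.2.2 = [] := List.length_eq_zero_iff.1 (by simp at hlt; omega)
  have hS : p.1 ∈ S := by
    by_contra hp
    obtain ⟨a, -, ha⟩ := h.fst_head hp
    simp [h1] at ha
  have hR : p.1 ∈ R := by
    by_contra hp
    obtain ⟨a, -, ha⟩ := h.snd_last hp
    simp [h2] at ha
  exact Finset.disjoint_left.1 hSR hS hR

end IsAbsorber

/-- Length of a path, plus `L` for each end at which it may still be extended. -/
def potential (S R : Finset V) (L : ℕ) (l : List V) : ℕ :=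
  l.length + (if ∃ a ∈ S, l.head? = some a then 0 else L) +
    (if ∃ b ∈ R, l.getLast? = some b then 0 else L)

/-- Absorption: given paths with few superfluous starts and ends at each vertex, and many
absorbers with each centre, one can rearrange all the arcs into a family of paths such that no
vertex is both a start and an end. -/
theorem exists_family_of_absorbers {S R : Finset V} (hSR : Disjoint S R) (L M : ℕ)
    (m : ℕ) : ∀ (Q : Multiset (List V)) (𝒜 : Finset (V × List V × List V)), #𝒜 = m →
    (∀ l ∈ Q, l.Nodup ∧ 2 ≤ l.length ∧ potential S R L l ≤ M) →
    (∀ p ∈ 𝒜, IsAbsorber S R L p) →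
    (∀ p ∈ 𝒜, ∀ q ∈ 𝒜, p.1 = q.1 → p ≠ q → ∀ v ∈ p.2.1 ++ p.2.2, v ∉ q.2.1 ++ q.2.2) →
    (∀ x ∈ S, 0 < startsAt Q x) → (∀ x ∈ R, 0 < endsAt Q x) →
    (∀ x, min (startsAt (Q + absorberPaths 𝒜) x) (endsAt (Q + absorberPaths 𝒜) x) + 2 * M
      ≤ #{p ∈ 𝒜 | p.1 = x}) →
    ∃ P : Multiset (List V), arcsOf P = arcsOf (Q + absorberPaths 𝒜) ∧
      (∀ l ∈ P, l.Nodup ∧ 2 ≤ l.length) ∧ ∀ v, startsAt P v = 0 ∨ endsAt P v = 0 := by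
  -- Each exchange spends one absorber, so the induction is on their number. `Q` holds the paths
  -- being rearranged, `𝒜` the absorbers still intact.
  induction m with
  | zero =>
    intro Q 𝒜 h𝒜 hQ hA hdisj hS hR hmin
    refine ⟨_, rfl, ?_, ?_⟩
    · rw [Finset.card_eq_zero] at h𝒜
      subst h𝒜
      intro l hl
      have := hQ l (by simpa [absorberPaths] using hl)
      exact ⟨this.1, this.2.1⟩
    · intro v
      have := hmin v
      rw [Finset.card_eq_zero.1 h𝒜] at *
      simp only [Finset.filter_empty, Finset.card_empty] at this
      omega
  | succ m ih =>
    intro Q 𝒜 h𝒜 hQ hA hdisj hS hR hmin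
    by_cases hend : ∀ v, startsAt (Q + absorberPaths 𝒜) v = 0 ∨ endsAt (Q + absorberPaths 𝒜) v = 0
    · refine ⟨_, rfl, ?_, hend⟩
      intro l hl
      rcases Multiset.mem_add.1 hl with hl | hl
      · exact ⟨(hQ l hl).1, (hQ l hl).2.1⟩
      · obtain ⟨p, hp, rfl⟩ := Multiset.mem_map.1 hl
        exact ⟨(hA p hp).nodup, (hA p hp).two_le_length hSR⟩
    push Not at hend
    obtain ⟨x, hx1, hx2⟩ := hend
    -- If the start at x comes from an intact absorber, then x ∈ S, and `Q` has a path starting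
    -- there too.
    obtain ⟨B, hB, hBx⟩ : ∃ l ∈ Q, l.head? = some x := by
      obtain ⟨l, hl, hlx⟩ := startsAt_pos.1 (Nat.pos_of_ne_zero hx1)
      rcases Multiset.mem_add.1 hl with hl | hl
      · exact ⟨l, hl, hlx⟩
      · obtain ⟨p, hp, rfl⟩ := Multiset.mem_map.1 hl
        obtain ⟨a, ha, ha'⟩ := (hA p hp).head_mem
        rw [ha', Option.some.injEq] at hlx
        exact startsAt_pos.1 (hS x (hlx ▸ ha))
    obtain ⟨A, hAQ, hAx⟩ : ∃ l ∈ Q, l.getLast? = some x := by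
      obtain ⟨l, hl, hlx⟩ := endsAt_pos.1 (Nat.pos_of_ne_zero hx2)
      rcases Multiset.mem_add.1 hl with hl | hl
      · exact ⟨l, hl, hlx⟩
      · obtain ⟨p, hp, rfl⟩ := Multiset.mem_map.1 hl
        obtain ⟨a, ha, ha'⟩ := (hA p hp).last_mem
        rw [ha', Option.some.injEq] at hlx
        exact endsAt_pos.1 (hR x (hlx ▸ ha))
    obtain ⟨A0, rfl⟩ := List.getLast?_eq_some_iff.1 hAx
    obtain ⟨B0, rfl⟩ := List.head?_eq_some_iff.1 hBx
    have hA0 : A0 ≠ [] := by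
      rintro rfl
      simpa using (hQ _ hAQ).2.1
    have hB0 : B0 ≠ [] := by
      rintro rfl
      simpa using (hQ _ hB).2.1
    have hxA0 : x ∉ A0 := fun h => by
      have := (hQ _ hAQ).1
      simp [List.nodup_append] at this
      exact this.2 x h rfl
    have hne : x :: B0 ≠ A0 ++ [x] := by
      obtain ⟨a, A1, rfl⟩ := List.exists_cons_of_ne_nil hA0
      intro h
      simp only [List.cons_append, List.cons.injEq] at h
      exact hxA0 (by simp [h.1])
    obtain ⟨Q1, rfl⟩ := Multiset.exists_cons_of_mem hAQ
    obtain ⟨Q0, rfl⟩ := Multiset.exists_cons_of_mem ((Multiset.mem_cons.1 hB).resolve_left hne)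
    -- choose an absorber avoiding both paths
    obtain ⟨p, hp, hpx, hpA⟩ : ∃ p ∈ 𝒜, p.1 = x ∧ ∀ v ∈ p.2.1 ++ p.2.2, v ∉ A0 ++ B0 := by
      by_contra! hcon
      -- Otherwise the absorbers at x meet the two paths in distinct vertices. There are more than
      -- 2M such absorbers, but fewer than 2M vertices.
      have hcard : #{p ∈ 𝒜 | p.1 = x} ≤ #(A0 ++ B0).toFinset := by
        have hmeet : ∀ p ∈ 𝒜.filter (fun p => p.1 = x), ∃ v ∈ p.2.1 ++ p.2.2, v ∈ A0 ++ B0 :=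
          fun p hp => hcon p (Finset.mem_filter.1 hp).1 (Finset.mem_filter.1 hp).2
        have : Nonempty V := ⟨x⟩
        choose! g hg1 hg2 using hmeet
        refine Finset.card_le_card_of_injOn g (fun p hp => by simpa using hg2 p hp) ?_
        intro p hp q hq hpq
        by_contra hne
        have hp' := Finset.mem_filter.1 hp
        have hq' := Finset.mem_filter.1 hq
        refine hdisj p hp'.1 q hq'.1 (hp'.2.trans hq'.2.symm) hne (g p) (hg1 p hp) ?_
        rw [hpq]
        exact hg1 q hq
      have h1 := List.toFinset_card_le (A0 ++ B0)
      have h2 := (hQ _ hAQ).2.2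
      have h3 := (hQ _ hB).2.2
      have h4 := hmin x
      simp only [potential, List.length_append, List.length_cons] at h1 h2 h3
      omega
    obtain ⟨x', α, β⟩ := p
    obtain rfl : x' = x := hpx
    have hab := hA _ hp
    simp only at hpA
    have hαβ : (α ++ x' :: β).Nodup := hab.nodup
    have hAn := (hQ _ hAQ).1
    have hBn := (hQ _ hB).1
    -- The exchange of tails at the centre.
    set Q' : Multiset (List V) := (A0 ++ x' :: β) ::ₘ (α ++ x' :: B0) ::ₘ Q0 with hQ'
    have habs : absorberPaths 𝒜 = (α ++ x' :: β) ::ₘ absorberPaths (𝒜.erase (x', α, β)) := by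
      rw [absorberPaths, ← Finset.insert_erase hp,
        Finset.insert_val_of_notMem (Finset.notMem_erase _ _), Multiset.map_cons]
      simp [absorberPaths]
    have hstarts : ∀ v, startsAt (((A0 ++ [x']) ::ₘ (x' :: B0) ::ₘ Q0) + absorberPaths 𝒜) v =
        startsAt (Q' + absorberPaths (𝒜.erase (x', α, β))) v + if x' = v then 1 else 0 := by
      intro v
      rw [habs, hQ']
      simp only [startsAt_add, startsAt_cons]
      rw [head?_append_cons A0 β, head?_append_cons α β, head?_append_cons α B0, List.head?_cons]
      simp only [Option.some.injEq]
      omega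
    have hends : ∀ v, endsAt (((A0 ++ [x']) ::ₘ (x' :: B0) ::ₘ Q0) + absorberPaths 𝒜) v =
        endsAt (Q' + absorberPaths (𝒜.erase (x', α, β))) v + if x' = v then 1 else 0 := by
      intro v
      rw [habs, hQ']
      simp only [endsAt_add, endsAt_cons]
      rw [getLast?_append_cons A0 β, getLast?_append_cons α β, getLast?_append_cons α B0,
        getLast?_append_cons A0 []]
      simp only [List.getLast?_singleton, Option.some.injEq]
      omega
    refine (ih Q' (𝒜.erase (x', α, β)) (by rw [Finset.card_erase_of_mem hp, h𝒜]; rfl)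
      ?_ ?_ ?_ ?_ ?_ ?_).imp fun P hP => ⟨hP.1.trans ?_, hP.2⟩
    · have hAp := (hQ _ hAQ).2.2
      have hBp := (hQ _ hB).2.2
      intro l hl
      rcases Multiset.mem_cons.1 hl with rfl | hl
      · refine ⟨?_, ?_, ?_⟩
        · rw [List.nodup_append] at hαβ hAn ⊢
          refine ⟨hAn.1, hαβ.2.1, ?_⟩
          rintro a ha b hb rfl
          rcases List.mem_cons.1 hb with rfl | hb
          · exact hxA0 ha
          · exact hpA a (by simp [hb]) (by simp [ha])
        · have := List.length_pos_iff.2 hA0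
          simp
          omega
        -- Either β is empty and nothing changes, or the new end lies in R and the summand L of
        -- `potential` pays for β.
        · by_cases hxR : x' ∈ R
          · have : β = [] := hab.snd_nil hxR
            rw [this]
            exact hAp
          · obtain ⟨b, hb, hb'⟩ := hab.snd_last hxR
            have h1 : (x' :: β).getLast? = some b := by simp at hb'; simp [List.getLast?_cons, hb']
            have h2 := hab.snd_length
            simp only [potential, head?_append_cons A0 β, getLast?_append_cons A0, h1] at hAp ⊢
            have h3 : ¬ ∃ b ∈ R, ([x'] : List V).getLast? = some b := by
              rintro ⟨b, hb, hb2⟩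
              simp at hb2
              exact hxR (hb2 ▸ hb)
            have h4 : ∃ b' ∈ R, (some b : Option V) = some b' := ⟨b, hb, rfl⟩
            rw [if_neg h3] at hAp
            rw [if_pos h4]
            simp at hAp h2 ⊢
            omega
      · rcases Multiset.mem_cons.1 hl with rfl | hl
        · refine ⟨?_, ?_, ?_⟩
          · rw [List.nodup_append] at hαβ ⊢
            refine ⟨hαβ.1, hBn, ?_⟩
            rintro a ha b hb rfl
            rcases List.mem_cons.1 hb with rfl | hb
            · exact hαβ.2.2 a ha a (by simp) rfl
            · exact hpA a (by simp [ha]) (by simp [hb])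
          · have := List.length_pos_iff.2 hB0
            simp
            omega
          · by_cases hxS : x' ∈ S
            · have : α = [] := hab.fst_nil hxS
              rw [this]
              exact hBp
            · obtain ⟨b, hb, hb'⟩ := hab.fst_head hxS
              have h1 : (α ++ x' :: B0).head? = some b := by
                simp only at hb'
                rw [List.head?_append, hb']
                rfl
              have h2 := hab.fst_length
              simp only [potential, getLast?_append_cons α, h1] at hBp ⊢
              have h3 : ¬ ∃ b ∈ S, (x' :: B0).head? = some b := by
                rintro ⟨b, hb, hb2⟩
                simp at hb2
                exact hxS (hb2 ▸ hb)
              have h4 : ∃ b' ∈ S, (some b : Option V) = some b' := ⟨b, hb, rfl⟩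
              rw [if_neg h3] at hBp
              rw [if_pos h4]
              simp only [List.length_cons, List.length_append] at hBp h2 ⊢
              omega
        · exact hQ l (by simp [hl])
    · exact fun q hq => hA q (Finset.mem_of_mem_erase hq)
    · exact fun q hq r hr => hdisj q (Finset.mem_of_mem_erase hq) r (Finset.mem_of_mem_erase hr)
    · intro v hv
      have h1 := hS v hv
      rw [hQ']
      simp only [startsAt_cons, head?_append_cons A0 β] at h1 ⊢
      by_cases hxv : x' = v
      · subst hxv
        have : α = [] := hab.fst_nil hv
        simp [this]
      · have : (x' :: B0).head? ≠ some v := by simpa using hxv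
        rw [if_neg this] at h1
        omega
    · intro v hv
      have h1 := hR v hv
      rw [hQ']
      simp only [endsAt_cons, getLast?_append_cons A0, getLast?_append_cons α B0] at h1 ⊢
      by_cases hxv : x' = v
      · subst hxv
        have : β = [] := hab.snd_nil hv
        simp [this]
      · have : ([x'] : List V).getLast? ≠ some v := by simpa using hxv
        rw [if_neg this] at h1
        omega
    · intro v
      have h1 := hmin v
      rw [hstarts, hends] at h1
      by_cases hxv : x' = v
      · subst hxv
        have h2 : #{q ∈ 𝒜.erase (x', α, β) | q.1 = x'} + 1 = #{q ∈ 𝒜 | q.1 = x'} := by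
          rw [Finset.filter_erase]
          exact Finset.card_erase_add_one (by simp [hp])
        rw [if_pos rfl] at h1
        omega
      · have h2 : {q ∈ 𝒜.erase (x', α, β) | q.1 = v} = {q ∈ 𝒜 | q.1 = v} := by
          rw [Finset.filter_erase]
          exact Finset.erase_eq_of_notMem (by simp [hxv])
        rw [if_neg hxv] at h1
        rw [h2]
        omega
    · rw [habs, hQ']
      simp only [arcsOf_add, arcsOf_cons]
      rw [arcs_append A0 β, arcs_append α B0, arcs_append α β]
      simp only [← Multiset.coe_add]
      abel

end PathDecomp

/-! ### Decomposition along colour differences. -/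

namespace PathDecomp

open Finset

variable {V : Type u} [DecidableEq V]

/-- Along an arc f/d rises by one modulo p, and f/d - 2 wraps from p - 1 to 0 only on arcs from
colour d to colour 2d, which are excluded. So its representative in [0, p) is a rank. The cut
depends on d so that each vertex lies at the cut for only a few differences. -/
lemma exists_family_of_difference {p : ℕ} [Fact p.Prime] (E : Finset (V × V)) (f : V → ZMod p)
    (d : ZMod p) (hd : d ≠ 0) (hE : ∀ e ∈ E, f e.2 - f e.1 = d ∧ f e.1 ≠ d) :
    ∃ P : Multiset (List V), arcsOf P = E.val ∧
      (∀ l ∈ P, l.Nodup ∧ 2 ≤ l.length ∧ l.length ≤ p) ∧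
      ∀ v, startsAt P v = 0 ∨ endsAt P v = 0 := by
  have hp : 1 < p := (Fact.out : p.Prime).one_lt
  obtain ⟨P, h1, h2, h3⟩ := exists_family_of_rank E (fun v => (f v / d - 2).val) (by
    rintro ⟨u, w⟩ he
    obtain ⟨hdiff, hne⟩ := hE _ he
    simp only at hdiff hne ⊢
    have hw : f w / d - 2 = (f u / d - 2) + 1 := by
      rw [show f w = f u + d by linear_combination hdiff]
      field_simp
      ring
    have hne0 : f w / d - 2 ≠ 0 := by
      rw [hw]
      intro h
      apply hne
      field_simp at h
      linear_combination h
    rw [hw] at hne0 ⊢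
    have hlt := ZMod.val_lt (f u / d - 2)
    rcases Nat.lt_or_ge ((f u / d - 2).val + 1) p with h | h
    · rw [ZMod.val_add_of_lt (by rwa [ZMod.val_one]), ZMod.val_one]
      omega
    · exfalso
      apply hne0
      rw [← ZMod.val_eq_zero, ZMod.val_add, ZMod.val_one,
        show (f u / d - 2).val + 1 = p by omega, Nat.mod_self])
  refine ⟨P, h1, fun l hl => ?_, h3⟩
  obtain ⟨h4, h5⟩ := h2 l hl
  have h6 : (l.map fun v => (f v / d - 2).val).Nodup := by
    rw [List.Nodup, List.pairwise_map]
    exact h5.imp fun h => h.ne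
  refine ⟨h6.of_map, h4, ?_⟩
  have h7 : (l.map fun v => (f v / d - 2).val).toFinset ⊆ Finset.range p := by
    intro i hi
    simp only [List.mem_toFinset, List.mem_map] at hi
    obtain ⟨v, -, rfl⟩ := hi
    exact Finset.mem_range.2 (ZMod.val_lt _)
  have h8 := Finset.card_le_card h7
  rw [List.toFinset_card_of_nodup h6] at h8
  simpa using h8

variable [Fintype V]

/-- The number of in-neighbours of `v` of colour `i`. -/
def inColour {ι : Type*} [DecidableEq ι] (E : Finset (V × V)) (f : V → ι) (v : V) (i : ι) : ℕ :=
  #{u | (u, v) ∈ E ∧ f u = i}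

/-- The number of out-neighbours of `v` of colour `i`. -/
def outColour {ι : Type*} [DecidableEq ι] (E : Finset (V × V)) (f : V → ι) (v : V) (i : ι) : ℕ :=
  #{w | (v, w) ∈ E ∧ f w = i}

/-- For most d the superfluous ends at v number at most the difference of two colour counts, hence
at most s. The exceptions cost at most c each: d = 0, where every arc is its own path; d = f v,
where the arcs out of v are cut; d = f v / 2, where the arcs into v are cut. Cut arcs become
single-arc paths. -/
lemma exists_family_of_class {p : ℕ} [Fact p.Prime] (hp2 : p ≠ 2) (E : Finset (V × V))
    (f : V → ZMod p) (s c : ℕ)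
    (hin : ∀ v, inCount E.val v ≤ outCount E.val v → ∀ i j, inColour E f v i ≤ outColour E f v j + s)
    (hout : ∀ v, outCount E.val v ≤ inCount E.val v → ∀ i j, outColour E f v i ≤ inColour E f v j + s)
    (hE : ∀ e ∈ E, e.1 ≠ e.2)
    (hinc : ∀ v i, inColour E f v i ≤ c) (houtc : ∀ v i, outColour E f v i ≤ c) (d : ZMod p) :
    ∃ Q : Multiset (List V), arcsOf Q = (E.filter fun e => f e.2 - f e.1 = d).val ∧
      (∀ l ∈ Q, l.Nodup ∧ 2 ≤ l.length ∧ l.length ≤ p) ∧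
      (∀ v, inCount E.val v ≤ outCount E.val v → endsAt Q v ≤ s +
        ((if d = 0 then c else 0) + (if d = f v then c else 0) + if d = f v / 2 then c else 0)) ∧
      (∀ v, outCount E.val v ≤ inCount E.val v → startsAt Q v ≤ s +
        ((if d = 0 then c else 0) + (if d = f v then c else 0) + if d = f v / 2 then c else 0)) := by
  have hp : 2 ≤ p := (Fact.out : p.Prime).two_le
  -- Needed so that f v = 2d determines d.
  have h2 : (2 : ZMod p) ≠ 0 := by
    have := (ZMod.natCast_eq_zero_iff 2 p).not.2 (fun h =>
      hp2 (le_antisymm (Nat.le_of_dvd (by norm_num) h) hp))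
    exact_mod_cast this
  have hpairs : ∀ F : Finset (V × V), F ⊆ E → ∀ l ∈ F.val.map (fun e => [e.1, e.2]),
      l.Nodup ∧ 2 ≤ l.length ∧ l.length ≤ p := by
    intro F hF l hl
    obtain ⟨e, he, rfl⟩ := Multiset.mem_map.1 hl
    simpa [hp] using hE e (hF he)
  by_cases hd : d = 0
  · refine ⟨(E.filter fun e => f e.2 - f e.1 = d).val.map fun e => [e.1, e.2],
      arcsOf_pairs _, hpairs _ (Finset.filter_subset _ _), fun v _ => ?_, fun v _ => ?_⟩
    · rw [endsAt_pairs, inCount_finset, if_pos hd]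
      refine le_trans ?_ (le_trans (hinc v (f v)) (by omega))
      refine Finset.card_le_card fun u => ?_
      simp only [Finset.mem_filter, Finset.mem_univ, true_and]
      rintro ⟨h, h'⟩
      exact ⟨h, by rw [hd] at h'; exact (sub_eq_zero.1 h').symm⟩
    · rw [startsAt_pairs, outCount_finset, if_pos hd]
      refine le_trans ?_ (le_trans (houtc v (f v)) (by omega))
      refine Finset.card_le_card fun u => ?_
      simp only [Finset.mem_filter, Finset.mem_univ, true_and]
      rintro ⟨h, h'⟩
      exact ⟨h, by rw [hd] at h'; exact sub_eq_zero.1 h'⟩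
  set F := E.filter fun e => f e.2 - f e.1 = d ∧ f e.1 ≠ d with hF
  set G := E.filter fun e => f e.2 - f e.1 = d ∧ f e.1 = d with hG
  obtain ⟨P, hP1, hP2, hP3⟩ := exists_family_of_difference F f d hd
    (fun e he => (Finset.mem_filter.1 he).2)
  have hFin : ∀ v, inCount F.val v = if d = f v / 2 then 0 else inColour E f v (f v - d) := by
    intro v
    rw [inCount_finset]
    split_ifs with h
    · rw [Finset.card_eq_zero, Finset.filter_eq_empty_iff]
      intro u _ hu
      obtain ⟨-, h3, h4⟩ := Finset.mem_filter.1 hu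
      apply h4
      simp only at h3 ⊢
      have : f v = 2 * d := by rw [h]; field_simp
      linear_combination this - h3
    · rw [inColour]
      congr 1
      ext u
      simp only [hF, Finset.mem_filter, Finset.mem_univ, true_and]
      refine and_congr_right fun _ => ⟨fun h3 => by linear_combination - h3.1, fun h3 => ?_⟩
      refine ⟨by linear_combination - h3, fun h4 => h ?_⟩
      field_simp
      linear_combination h3 - h4
  have hFout : ∀ v, outCount F.val v = if d = f v then 0 else outColour E f v (f v + d) := by
    intro v
    rw [outCount_finset]
    split_ifs with h
    · rw [Finset.card_eq_zero, Finset.filter_eq_empty_iff]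
      intro u _ hu
      obtain ⟨-, h3, h4⟩ := Finset.mem_filter.1 hu
      exact h4 h.symm
    · rw [outColour]
      congr 1
      ext u
      simp only [hF, Finset.mem_filter, Finset.mem_univ, true_and]
      refine and_congr_right fun _ => ⟨fun h3 => by linear_combination h3.1, fun h3 => ?_⟩
      exact ⟨by linear_combination h3, fun h4 => h h4.symm⟩
  have hGin : ∀ v, inCount G.val v ≤ if d = f v / 2 then c else 0 := by
    intro v
    rw [inCount_finset]
    split_ifs with h
    · refine le_trans (Finset.card_le_card fun u => ?_) (hinc v d)
      simp only [hG, Finset.mem_filter, Finset.mem_univ, true_and]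
      exact fun h => ⟨h.1, h.2.2⟩
    · rw [Nat.le_zero, Finset.card_eq_zero, Finset.filter_eq_empty_iff]
      intro u _ hu
      obtain ⟨-, h3, h4⟩ := Finset.mem_filter.1 hu
      apply h
      simp only at h3 h4
      field_simp
      linear_combination - h3 - h4
  have hGout : ∀ v, outCount G.val v ≤ if d = f v then c else 0 := by
    intro v
    rw [outCount_finset]
    split_ifs with h
    · refine le_trans (Finset.card_le_card fun u => ?_) (houtc v (f v + d))
      simp only [hG, Finset.mem_filter, Finset.mem_univ, true_and]
      exact fun h => ⟨h.1, by linear_combination h.2.1⟩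
    · rw [Nat.le_zero, Finset.card_eq_zero, Finset.filter_eq_empty_iff]
      intro u _ hu
      obtain ⟨-, h3, h4⟩ := Finset.mem_filter.1 hu
      exact h h4.symm
  refine ⟨P + G.val.map fun e => [e.1, e.2], ?_, ?_, fun v hv => ?_, fun v hv => ?_⟩
  · rw [arcsOf_add, arcsOf_pairs, hP1, hF, hG, Finset.filter_val, Finset.filter_val,
      Finset.filter_val, ← Multiset.filter_filter, ← Multiset.filter_filter, add_comm]
    have := Multiset.filter_add_not (fun e : V × V => f e.1 = d)
      (Multiset.filter (fun e : V × V => f e.2 - f e.1 = d) E.val)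
    simp only [Multiset.filter_filter, and_comm] at this ⊢
    exact this
  · intro l hl
    rcases Multiset.mem_add.1 hl with hl | hl
    · exact hP2 l hl
    · exact hpairs G (Finset.filter_subset _ _) l hl
  · rw [endsAt_add, endsAt_pairs]
    have hbal := outCount_arcsOf_add_endsAt P v
    rw [hP1, hFin, hFout] at hbal
    have h3 := hP3 v
    have h4 := hGin v
    have h5 := hin v hv (f v - d) (f v + d)
    have h6 := hinc v (f v - d)
    split_ifs at * <;> omega
  · rw [startsAt_add, startsAt_pairs]
    have hbal := outCount_arcsOf_add_endsAt P v
    rw [hP1, hFin, hFout] at hbal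
    have h3 := hP3 v
    have h4 := hGout v
    have h5 := hout v hv (f v + d) (f v - d)
    have h6 := houtc v (f v + d)
    split_ifs at * <;> omega

/-- A digraph whose vertices are coloured with `ZMod p` so that all colours are seen about equally
often decomposes into paths of length less than `p` with few superfluous ends. -/
theorem exists_family_of_colouring {p : ℕ} [Fact p.Prime] (hp2 : p ≠ 2) (E : Finset (V × V))
    (f : V → ZMod p) (s c : ℕ)
    (hin : ∀ v, inCount E.val v ≤ outCount E.val v → ∀ i j, inColour E f v i ≤ outColour E f v j + s)
    (hout : ∀ v, outCount E.val v ≤ inCount E.val v → ∀ i j, outColour E f v i ≤ inColour E f v j + s)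
    (hE : ∀ e ∈ E, e.1 ≠ e.2)
    (hinc : ∀ v i, inColour E f v i ≤ c) (houtc : ∀ v i, outColour E f v i ≤ c) :
    ∃ Q : Multiset (List V), arcsOf Q = E.val ∧
      (∀ l ∈ Q, l.Nodup ∧ 2 ≤ l.length ∧ l.length ≤ p) ∧
      (∀ v, inCount E.val v ≤ outCount E.val v → endsAt Q v ≤ p * s + 3 * c) ∧
      (∀ v, outCount E.val v ≤ inCount E.val v → startsAt Q v ≤ p * s + 3 * c) := by
  choose Q hQ1 hQ2 hQ3 hQ4 using
    exists_family_of_class hp2 E f s c hin hout hE hinc houtc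
  have hsum : ∀ D : Finset (ZMod p), arcsOf (∑ d ∈ D, Q d) = (∑ d ∈ D, arcsOf (Q d)) ∧
      ∀ v, startsAt (∑ d ∈ D, Q d) v = (∑ d ∈ D, startsAt (Q d) v) ∧
      endsAt (∑ d ∈ D, Q d) v = (∑ d ∈ D, endsAt (Q d) v) := by
    intro D
    induction D using Finset.induction_on with
    | empty => simp
    | insert d D hd ih =>
      rw [Finset.sum_insert hd, Finset.sum_insert hd, arcsOf_add, ih.1]
      refine ⟨rfl, fun v => ?_⟩
      rw [Finset.sum_insert hd, Finset.sum_insert hd, startsAt_add, endsAt_add, (ih.2 v).1,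
        (ih.2 v).2]
      exact ⟨rfl, rfl⟩
  have hbound : ∀ v, ∑ d : ZMod p, (s + ((if d = 0 then c else 0) + (if d = f v then c else 0) +
      if d = f v / 2 then c else 0)) = p * s + 3 * c := by
    intro v
    simp only [Finset.sum_add_distrib, Finset.sum_ite_eq', Finset.mem_univ, if_true,
      Finset.sum_const, Finset.card_univ, ZMod.card, smul_eq_mul]
    ring
  refine ⟨∑ d, Q d, ?_, ?_, fun v hv => ?_, fun v hv => ?_⟩
  · rw [(hsum _).1]
    ext e
    rw [Multiset.count_sum']
    simp only [hQ1, Finset.filter_val, Multiset.count_filter]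
    rw [Finset.sum_ite_eq]
    simp
  · intro l hl
    obtain ⟨d, -, hd⟩ := Multiset.mem_sum.1 hl
    exact hQ2 d l hd
  · rw [((hsum _).2 v).2, ← hbound v]
    exact Finset.sum_le_sum fun d _ => hQ3 d v hv
  · rw [((hsum _).2 v).1, ← hbound v]
    exact Finset.sum_le_sum fun d _ => hQ4 d v hv

end PathDecomp

/-! ### Balanced colourings by the exponential moment method. -/

namespace PathDecomp

open Finset

section Colouring

variable {V ι : Type*} [Fintype V] [DecidableEq V] [Fintype ι] [DecidableEq ι]

/-- The deviation of the number of vertices of colour `i` in `W` from its mean. -/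
noncomputable def colourDeviation (W : Finset V) (f : V → ι) (i : ι) : ℝ :=
  #{w ∈ W | f w = i} - (#W : ℝ) / Fintype.card ι

/-- The sum over all colourings factorises over the vertices. In each factor use exp y ≤ 1 + y + y²
for |y| ≤ 1; the linear terms cancel because the indicator is centred. -/
lemma sum_exp_colourDeviation_le [Nonempty ι] (W : Finset V) (i : ι) {r : ℝ} (hr : |r| ≤ 1) :
    ∑ f : V → ι, Real.exp (r * colourDeviation W f i) ≤
      (Fintype.card ι : ℝ) ^ Fintype.card V * Real.exp (Fintype.card V * r ^ 2) := by
  set p : ℝ := (Fintype.card ι : ℝ) with hp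
  have hp1 : 1 ≤ p := by rw [hp]; exact_mod_cast Fintype.card_pos
  have hp0 : p ≠ 0 := by positivity
  let y : V → ι → ℝ := fun w c => if w ∈ W then r * ((if c = i then 1 else 0) - 1 / p) else 0
  have hdev : ∀ f : V → ι, r * colourDeviation W f i = ∑ w, y w (f w) := by
    intro f
    simp only [y, Finset.sum_ite_mem, Finset.univ_inter]
    rw [← Finset.mul_sum, Finset.sum_sub_distrib, Finset.sum_boole, Finset.sum_const, nsmul_eq_mul,
      colourDeviation]
    ring
  have h1 : ∑ f : V → ι, Real.exp (r * colourDeviation W f i) = ∏ w, ∑ c, Real.exp (y w c) := by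
    rw [Finset.prod_univ_sum, Fintype.piFinset_univ]
    refine Finset.sum_congr rfl fun f _ => ?_
    rw [hdev, Real.exp_sum]
  have h2 : ∀ w, ∑ c, Real.exp (y w c) ≤ p * Real.exp (r ^ 2) := by
    intro w
    have hq : ∀ c, |(if c = i then (1 : ℝ) else 0) - 1 / p| ≤ 1 := by
      intro c
      have h3 : 0 ≤ 1 / p := by positivity
      have h4 : 1 / p ≤ 1 := by rw [div_le_one (by positivity)]; exact hp1
      rw [abs_le]
      split_ifs <;> constructor <;> linarith
    have hyr : ∀ c, |y w c| ≤ |r| := by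
      intro c
      by_cases hw : w ∈ W
      · simp only [y, if_pos hw]
        rw [abs_mul]
        exact mul_le_of_le_one_right (abs_nonneg _) (hq c)
      · simp [y, hw]
    have hexp : ∀ c, Real.exp (y w c) ≤ 1 + y w c + r ^ 2 := by
      intro c
      have h3 := Real.abs_exp_sub_one_sub_id_le ((hyr c).trans hr)
      have h4 : y w c ^ 2 ≤ r ^ 2 := sq_le_sq.2 (hyr c)
      have := (abs_le.1 h3).2
      linarith
    have hzero : ∑ c, y w c = 0 := by
      simp only [y]
      split_ifs
      · rw [← Finset.mul_sum, Finset.sum_sub_distrib]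
        simp [← hp, hp0]
      · simp
    calc ∑ c, Real.exp (y w c) ≤ ∑ c, (1 + y w c + r ^ 2) := Finset.sum_le_sum fun c _ => hexp c
      _ = p * (r ^ 2 + 1) := by
        rw [Finset.sum_add_distrib, Finset.sum_add_distrib, hzero]
        simp [← hp]
        ring
      _ ≤ p * Real.exp (r ^ 2) := by
        gcongr
        exact Real.add_one_le_exp _
  rw [h1]
  calc ∏ w, ∑ c, Real.exp (y w c) ≤ ∏ _w : V, (p * Real.exp (r ^ 2)) :=
        Finset.prod_le_prod (fun w _ => Finset.sum_nonneg fun c _ => (Real.exp_pos _).le)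
          fun w _ => h2 w
    _ = _ := by rw [Finset.prod_const, Finset.card_univ, mul_pow, ← Real.exp_nat_mul]

/-- Some colouring splits every set of a small family about evenly. -/
theorem exists_balanced_colouring {J : Type*} [Fintype J] [Nonempty ι] (W : J → Finset V) (τ : ℝ)
    (hτ0 : 0 ≤ τ) (hτ : τ ≤ 2 * Fintype.card V)
    (h : 2 * (Fintype.card J : ℝ) * Fintype.card ι < Real.exp (τ ^ 2 / (4 * Fintype.card V))) :
    ∃ f : V → ι, ∀ j i, |colourDeviation (W j) f i| ≤ τ := by
  by_contra! hcon
  set n : ℝ := (Fintype.card V : ℝ) with hn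
  set p : ℝ := (Fintype.card ι : ℝ) with hp
  have hp0 : 0 < p := by rw [hp]; exact_mod_cast Fintype.card_pos
  obtain ⟨f0⟩ : Nonempty (V → ι) := inferInstance
  have hn0 : 0 < n := by
    rcases isEmpty_or_nonempty V with hV | hV
    · obtain ⟨j, i, hji⟩ := hcon f0
      have hW : W j = ∅ := Finset.eq_empty_of_isEmpty _
      rw [colourDeviation, hW] at hji
      simp at hji
      linarith
    · rw [hn]
      exact_mod_cast Fintype.card_pos
  -- This r minimises n r² - r τ, with value -τ²/(4n).
  set r := τ / (2 * n) with hr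
  have hr0 : 0 ≤ r := by positivity
  have hr1 : |r| ≤ 1 := by
    rw [abs_of_nonneg hr0, hr, div_le_one (by positivity)]
    exact hτ
  have hcount : (∑ _f : V → ι, (1 : ℝ)) = p ^ Fintype.card V := by
    simp [hp]
  -- Union bound: if every colouring is bad, each has a term this large; the signs ±r cover the two
  -- tails.
  have hlow : ∀ f : V → ι, Real.exp (r * τ) ≤ ∑ j, ∑ i, (Real.exp (r * colourDeviation (W j) f i) +
      Real.exp (-r * colourDeviation (W j) f i)) := by
    intro f
    obtain ⟨j, i, hji⟩ := hcon f
    have h1 : Real.exp (r * τ) ≤ Real.exp (r * colourDeviation (W j) f i) +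
        Real.exp (-r * colourDeviation (W j) f i) := by
      rcases lt_abs.1 hji with h | h
      · have : Real.exp (r * τ) ≤ Real.exp (r * colourDeviation (W j) f i) := by gcongr
        linarith [Real.exp_pos (-r * colourDeviation (W j) f i)]
      · have : Real.exp (r * τ) ≤ Real.exp (-r * colourDeviation (W j) f i) := by
          rw [neg_mul, ← mul_neg]
          gcongr
        linarith [Real.exp_pos (r * colourDeviation (W j) f i)]
    refine h1.trans ?_
    refine le_trans ?_ (Finset.single_le_sum (f := fun j => ∑ i, (Real.exp (r *
      colourDeviation (W j) f i) + Real.exp (-r * colourDeviation (W j) f i)))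
      (fun j _ => by positivity) (Finset.mem_univ j))
    exact Finset.single_le_sum (f := fun i => Real.exp (r * colourDeviation (W j) f i) +
      Real.exp (-r * colourDeviation (W j) f i)) (fun i _ => by positivity) (Finset.mem_univ i)
  have hup : ∑ f : V → ι, ∑ j, ∑ i, (Real.exp (r * colourDeviation (W j) f i) +
      Real.exp (-r * colourDeviation (W j) f i)) ≤
      Fintype.card J * (p * (2 * (p ^ Fintype.card V * Real.exp (n * r ^ 2)))) := by
    rw [Finset.sum_comm]
    refine (Finset.sum_le_card_nsmul _ _ (p * (2 * (p ^ Fintype.card V * Real.exp (n * r ^ 2))))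
      fun j _ => ?_).trans_eq (by simp)
    rw [Finset.sum_comm]
    refine (Finset.sum_le_card_nsmul _ _ (2 * (p ^ Fintype.card V * Real.exp (n * r ^ 2)))
      fun i _ => ?_).trans_eq (by simp [hp])
    rw [Finset.sum_add_distrib, two_mul]
    refine add_le_add (sum_exp_colourDeviation_le (W j) i hr1) ?_
    have := sum_exp_colourDeviation_le (W j) i (r := -r) (by rwa [abs_neg])
    rwa [neg_sq] at this
  have hsum := (Finset.sum_le_sum fun f (_ : f ∈ Finset.univ) => hlow f).trans hup
  have hleft : ∑ _f : V → ι, Real.exp (r * τ) = p ^ Fintype.card V * Real.exp (r * τ) := by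
    simp [hp]
  have hexp : Real.exp (r * τ) = Real.exp (n * r ^ 2) * Real.exp (τ ^ 2 / (4 * n)) := by
    rw [← Real.exp_add]
    congr 1
    rw [hr]
    field_simp
    ring
  rw [hleft, hexp] at hsum
  have hpos : 0 < p ^ Fintype.card V * Real.exp (n * r ^ 2) := by positivity
  have : p ^ Fintype.card V * Real.exp (n * r ^ 2) * Real.exp (τ ^ 2 / (4 * n)) ≤
      p ^ Fintype.card V * Real.exp (n * r ^ 2) * (2 * (Fintype.card J : ℝ) * p) := by
    linarith
  have := le_of_mul_le_mul_left this hpos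
  linarith

end Colouring

end PathDecomp

/-! ### Short connecting paths. -/

namespace PathDecomp

open Finset

section Reach

variable {V : Type u} [Fintype V] [DecidableEq V]

open scoped Classical in
/-- If the complement of every set containing `x` and avoiding `Y` is about halved by adding the
in-neighbours of the set, then there is a short path from `Y` to `x`. -/
lemma exists_short_path {r : V → V → Prop} (x : V) (Y : Finset V) (c L : ℕ)
    (h : ∀ S : Finset V, x ∈ S → Disjoint S Y → #Sᶜ ≤ 2 * #{w ∈ Sᶜ | ∃ u ∈ S, r w u} + c)
    (hL : Fintype.card V ≤ 2 ^ L) (hY : c + 1 < #Y) :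
    ∃ l : List V, (∃ a ∈ Y, (l ++ [x]).head? = some a) ∧ (l ++ [x]).Nodup ∧
      (l ++ [x]).IsChain r ∧ l.length ≤ L := by
  -- Backward search: while S misses Y, its complement has at most c + n/2^i vertices. Keeping the
  -- paths inside S ensures that prepending a new vertex leaves them simple.
  have key : ∀ i : ℕ, ∃ S : Finset V, x ∈ S ∧
      (∀ u ∈ S, ∃ l : List V, (l ++ [x]).head? = some u ∧ (l ++ [x]).Nodup ∧
        (l ++ [x]).IsChain r ∧ l.length ≤ i ∧ ∀ v ∈ l ++ [x], v ∈ S) ∧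
      (Disjoint S Y → #Sᶜ * 2 ^ i ≤ c * 2 ^ i + Fintype.card V) := by
    intro i
    induction i with
    | zero =>
      refine ⟨{x}, by simp, ?_, fun _ => ?_⟩
      · intro u hu
        exact ⟨[], by simp [Finset.mem_singleton.1 hu], by simp, by simp, by simp, by simp⟩
      · have := Finset.card_le_univ ({x} : Finset V)ᶜ
        omega
    | succ i ih =>
      obtain ⟨S, hxS, hS, hSc⟩ := ih
      refine ⟨S ∪ {w ∈ Sᶜ | ∃ u ∈ S, r w u}, by simp [hxS], ?_, fun hd => ?_⟩
      · intro w hw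
        rcases Finset.mem_union.1 hw with hw | hw
        · obtain ⟨l, h1, h2, h3, h4, h5⟩ := hS w hw
          exact ⟨l, h1, h2, h3, by omega, fun v hv => Finset.mem_union_left _ (h5 v hv)⟩
        · have hw' := hw
          simp only [Finset.mem_filter, Finset.mem_compl] at hw'
          obtain ⟨hwS, u, hu, hwu⟩ := hw'
          obtain ⟨l, h1, h2, h3, h4, h5⟩ := hS u hu
          refine ⟨w :: l, by simp, ?_, ?_, by simpa using h4, ?_⟩
          · rw [List.cons_append, List.nodup_cons]
            exact ⟨fun hwl => hwS (h5 w hwl), h2⟩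
          · obtain ⟨l', hl'⟩ := List.head?_eq_some_iff.1 h1
            rw [List.cons_append, hl', List.isChain_cons_cons]
            exact ⟨hwu, hl' ▸ h3⟩
          · intro v hv
            rw [List.cons_append, List.mem_cons] at hv
            rcases hv with rfl | hv
            · exact Finset.mem_union_right _ (by assumption)
            · exact Finset.mem_union_left _ (h5 v hv)
      · have hdS : Disjoint S Y := Finset.disjoint_of_subset_left Finset.subset_union_left hd
        have h1 := hSc hdS
        have h2 := h S hxS hdS
        have h3 : #(S ∪ {w ∈ Sᶜ | ∃ u ∈ S, r w u})ᶜ + #{w ∈ Sᶜ | ∃ u ∈ S, r w u} = #Sᶜ := by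
          rw [Finset.compl_union, ← Finset.sdiff_eq_inter_compl]
          exact Finset.card_sdiff_add_card_eq_card (Finset.filter_subset _ _)
        have h4 : 2 * #(S ∪ {w ∈ Sᶜ | ∃ u ∈ S, r w u})ᶜ ≤ #Sᶜ + c := by omega
        calc _ = 2 * #(S ∪ {w ∈ Sᶜ | ∃ u ∈ S, r w u})ᶜ * 2 ^ i := by rw [pow_succ]; ring
          _ ≤ (#Sᶜ + c) * 2 ^ i := Nat.mul_le_mul_right _ h4
          _ ≤ _ := by rw [pow_succ]; linarith
  -- Now the complement would have at most c + 1 vertices, too few to contain Y.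
  obtain ⟨S, -, hS, hSc⟩ := key L
  have hnd : ¬ Disjoint S Y := by
    intro hd
    have h1 := hSc hd
    have h2 : #Y ≤ #Sᶜ := Finset.card_le_card fun y hy => Finset.mem_compl.2 fun hyS =>
      Finset.disjoint_left.1 hd hyS hy
    have h3 : (c + 2) * 2 ^ L ≤ #Sᶜ * 2 ^ L := Nat.mul_le_mul_right _ (by omega)
    have h4 : 0 < 2 ^ L := by positivity
    nlinarith
  obtain ⟨u, hu, huY⟩ := Finset.not_disjoint_iff.1 hnd
  obtain ⟨l, h1, h2, h3, h4, -⟩ := hS u hu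
  exact ⟨l, ⟨u, huY, h1⟩, h2, h3, h4⟩

open scoped Classical in
-- Arcs inside S count equally in both degree sums, so at least half of #S · (#Sᶜ - t) arcs enter S
-- from outside. Each u ∈ S receives at most D of them through `U`, at most z from `Z`, and the rest
-- from the new neighbours.
lemma card_compl_le_of_total {A U r : V → V → Prop} [DecidableRel A] [DecidableRel U]
    (hA : ∀ u v, u ≠ v → A u v ∨ A v u)
    (S Z : Finset V)
    {t D z : ℕ} (hS : S.Nonempty) (hr : ∀ w u, A w u → ¬ U w u → w ∉ Z → r w u)
    (ht : ∀ u ∈ S, #{w | A u w} ≤ #{w | A w u} + t) (hU : ∀ u, #{w | U w u} ≤ D) (hZ : #Z ≤ z) :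
    #Sᶜ ≤ 2 * #{w ∈ Sᶜ | ∃ u ∈ S, r w u} + (t + 2 * D + 2 * z) := by
  set N := {w ∈ Sᶜ | ∃ u ∈ S, r w u} with hN
  have hsplit : ∀ (B : V → Prop) [DecidablePred B], #{w | B w} = #{w ∈ S | B w} + #{w ∈ Sᶜ | B w} := by
    intro B _
    rw [← Finset.card_union_of_disjoint, ← Finset.filter_union, Finset.union_compl]
    exact Finset.disjoint_filter_filter disjoint_compl_right
  have hinner : ∑ u ∈ S, #{w ∈ S | A u w} = ∑ u ∈ S, #{w ∈ S | A w u} :=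
    Finset.sum_card_bipartiteAbove_eq_sum_card_bipartiteBelow A
  have h1 : ∑ u ∈ S, #{w ∈ Sᶜ | A u w} ≤ ∑ u ∈ S, #{w ∈ Sᶜ | A w u} + #S * t := by
    have ht' : ∀ u ∈ S, #{w ∈ S | A u w} + #{w ∈ Sᶜ | A u w} ≤
        #{w ∈ S | A w u} + #{w ∈ Sᶜ | A w u} + t := by
      intro u hu
      rw [← hsplit, ← hsplit]
      exact ht u hu
    have := Finset.sum_le_sum ht'
    simp only [Finset.sum_add_distrib, Finset.sum_const, smul_eq_mul] at this
    omega
  have h2 : ∀ u ∈ S, #Sᶜ ≤ #{w ∈ Sᶜ | A u w} + #{w ∈ Sᶜ | A w u} := by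
    intro u hu
    refine le_trans (Finset.card_le_card fun w hw => ?_) (Finset.card_union_le _ _)
    have hne : u ≠ w := fun h => Finset.mem_compl.1 hw (h ▸ hu)
    simp only [Finset.mem_union, Finset.mem_filter]
    exact (hA u w hne).imp (fun h => ⟨hw, h⟩) fun h => ⟨hw, h⟩
  have h3 : ∀ u ∈ S, #{w ∈ Sᶜ | A w u} ≤ #N + (D + z) := by
    intro u hu
    have hsub : {w ∈ Sᶜ | A w u} ⊆ N ∪ (({w | U w u} : Finset V) ∪ Z) := by
      intro w hw
      simp only [hN, Finset.mem_union, Finset.mem_filter, Finset.mem_univ, true_and] at hw ⊢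
      by_cases hw1 : U w u
      · exact Or.inr (Or.inl hw1)
      by_cases hw2 : w ∈ Z
      · exact Or.inr (Or.inr hw2)
      exact Or.inl ⟨hw.1, u, hu, hr w u hw.2 hw1 hw2⟩
    refine (Finset.card_le_card hsub).trans ((Finset.card_union_le _ _).trans ?_)
    exact Nat.add_le_add_left ((Finset.card_union_le _ _).trans (Nat.add_le_add (hU u) hZ)) _
  have h4 := Finset.sum_le_sum h2
  have h5 := Finset.sum_le_sum h3
  simp only [Finset.sum_const, smul_eq_mul, Finset.sum_add_distrib] at h4 h5
  have hpos : 0 < #S := hS.card_pos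
  refine Nat.le_of_mul_le_mul_left ?_ hpos
  nlinarith

/-- In a tournament-like relation, every vertex can be reached from a large set containing all
vertices of large excess, avoiding a few arcs at each vertex and a few vertices. -/
lemma exists_connector {A U : V → V → Prop} [DecidableRel A] [DecidableRel U]
    (hA : ∀ u v, u ≠ v → A u v ∨ A v u) (S Z : Finset V) (x : V) {t D z L : ℕ}
    (hS : ∀ u ∉ S, #{w | A u w} ≤ #{w | A w u} + t)
    (hU : ∀ u, #{w | U w u} ≤ D) (hZ : #Z ≤ z) (hL : Fintype.card V ≤ 2 ^ L)
    (hc : t + 2 * D + 2 * z + 1 < #S) :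
    ∃ α : List V, (α ++ [x]).Nodup ∧ α.length ≤ L ∧ (x ∈ S → α = []) ∧
      (x ∉ S → ∃ a ∈ S, α.head? = some a) ∧ (α ++ [x]).IsChain (fun w u => A w u ∧ ¬ U w u) ∧
      ∀ v ∈ α, v ∉ Z := by
  by_cases hxS : x ∈ S
  · exact ⟨[], by simp, by simp, by simp, by simp [hxS], by simp, by simp⟩
  -- Only tails of arcs are kept out of `Z`, so x, the last vertex, may lie in it.
  obtain ⟨l, ⟨a, ha, hla⟩, h1, h2, h3⟩ := exists_short_path
    (r := fun w u => A w u ∧ ¬ U w u ∧ w ∉ Z) x S (t + 2 * D + 2 * z) L (by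
    intro S' hxS' hd
    exact card_compl_le_of_total hA S' Z ⟨x, hxS'⟩ (fun _ _ h1 h2 h3 => ⟨h1, h2, h3⟩)
      (fun u hu => hS u (Finset.disjoint_left.1 hd hu)) hU hZ) hL hc
  refine ⟨l, h1, h3, fun h => absurd h hxS, fun _ => ⟨a, ha, ?_⟩,
    h2.imp fun _ _ h => ⟨h.1, h.2.1⟩, ?_⟩
  · cases l with
    | nil =>
      simp at hla
      exact absurd (hla ▸ ha) hxS
    | cons b l => simpa using hla
  · clear h1 h3 hla
    induction l with
    | nil => simp
    | cons b l ih =>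
      intro v hv
      rw [List.cons_append, List.isChain_cons] at h2
      rcases List.mem_cons.1 hv with rfl | hv
      · obtain ⟨c, l', hc⟩ := List.exists_cons_of_ne_nil (l := l ++ [x]) (by simp)
        exact (h2.1 c (by rw [hc]; simp)).2.2
      · exact ih h2.2 v hv

end Reach

/-! ### Greedy construction of the absorbers. -/

section System

variable {V : Type u} [Fintype V] [DecidableEq V]

/-- A system of edge-disjoint absorbers of a digraph, with at most `k` absorbers for each centre,
those with the same centre meeting only there, and with every vertex on at most `Δ` absorbers
with other centres. -/
structure IsAbsorberSystem (T : Digraph V) (S R : Finset V) (L k Δ : ℕ)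
    (𝒜 : Finset (V × List V × List V)) : Prop where
  absorber : ∀ p ∈ 𝒜, IsAbsorber S R L p
  disjoint : ∀ p ∈ 𝒜, ∀ q ∈ 𝒜, p.1 = q.1 → p ≠ q → ∀ v ∈ p.2.1 ++ p.2.2, v ∉ q.2.1 ++ q.2.2
  arcs_le : arcsOf (absorberPaths 𝒜) ≤ (arcFinset T).val
  card_le : ∀ x, #{p ∈ 𝒜 | p.1 = x} ≤ k
  load_le : ∀ v, #{p ∈ 𝒜 | v ∈ p.2.1 ++ p.2.2} ≤ Δ

namespace IsAbsorberSystem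

variable {T : Digraph V} {S R : Finset V} {L k Δ : ℕ} {𝒜 : Finset (V × List V × List V)}

lemma countP_mem_le (h : IsAbsorberSystem T S R L k Δ 𝒜) (v : V) :
    (absorberPaths 𝒜).countP (fun l => v ∈ l) ≤ Δ + k := by
  rw [absorberPaths, Multiset.countP_map, ← Finset.filter_val, Finset.card_val]
  refine le_trans (Finset.card_le_card (t := {p ∈ 𝒜 | v ∈ p.2.1 ++ p.2.2} ∪ {p ∈ 𝒜 | p.1 = v})
    fun p hp => ?_) ((Finset.card_union_le _ _).trans (Nat.add_le_add (h.load_le v) (h.card_le v)))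
  simp only [Finset.mem_filter, Finset.mem_union, List.mem_append, List.mem_cons] at hp ⊢
  rcases hp.2 with h1 | h1 | h1
  · exact Or.inl ⟨hp.1, Or.inl h1⟩
  · exact Or.inr ⟨hp.1, h1.symm⟩
  · exact Or.inl ⟨hp.1, Or.inr h1⟩

lemma nodup (h : IsAbsorberSystem T S R L k Δ 𝒜) : ∀ l ∈ absorberPaths 𝒜, l.Nodup := by
  intro l hl
  obtain ⟨p, hp, rfl⟩ := Multiset.mem_map.1 hl
  exact (h.absorber p hp).nodup

lemma card_in_le (h : IsAbsorberSystem T S R L k Δ 𝒜) (v : V) :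
    #{w | (w, v) ∈ arcsOf (absorberPaths 𝒜)} ≤ Δ + k := by
  have h1 := inCount_finset (arcsOf (absorberPaths 𝒜)).toFinset v
  simp only [Multiset.mem_toFinset] at h1
  rw [← h1]
  refine le_trans ?_ (((outCount_arcsOf_le _ h.nodup v).2).trans (h.countP_mem_le v))
  exact Multiset.countP_le_of_le _ (Multiset.dedup_le _)

lemma card_out_le (h : IsAbsorberSystem T S R L k Δ 𝒜) (v : V) :
    #{w | (v, w) ∈ arcsOf (absorberPaths 𝒜)} ≤ Δ + k := by
  have h1 := outCount_finset (arcsOf (absorberPaths 𝒜)).toFinset v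
  simp only [Multiset.mem_toFinset] at h1
  rw [← h1]
  refine le_trans ?_ (((outCount_arcsOf_le _ h.nodup v).1).trans (h.countP_mem_le v))
  exact Multiset.countP_le_of_le _ (Multiset.dedup_le _)

lemma card_le_mul (h : IsAbsorberSystem T S R L k Δ 𝒜) : #𝒜 ≤ Fintype.card V * k := by
  rw [Finset.card_eq_sum_card_fiberwise (f := Prod.fst) (t := Finset.univ) (fun _ _ => by simp)]
  exact (Finset.sum_le_card_nsmul _ _ k fun x _ => h.card_le x).trans_eq (by simp)

/-- Double counting: at most nk absorbers have at most 2L vertices each besides the centre. -/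
lemma card_overloaded_le (h : IsAbsorberSystem T S R L k Δ 𝒜) {z : ℕ} (hΔ : 0 < Δ)
    (hz : 2 * L * k * Fintype.card V ≤ Δ * z) :
    #{v | Δ ≤ #{p ∈ 𝒜 | v ∈ p.2.1 ++ p.2.2}} ≤ z := by
  have h1 : ∑ v, #{p ∈ 𝒜 | v ∈ p.2.1 ++ p.2.2} ≤ #𝒜 * (2 * L) := by
    have := Finset.sum_card_bipartiteAbove_eq_sum_card_bipartiteBelow (s := (Finset.univ : Finset V))
      (t := 𝒜) (fun v p => v ∈ p.2.1 ++ p.2.2)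
    simp only [Finset.bipartiteAbove, Finset.bipartiteBelow] at this
    rw [this]
    refine Finset.sum_le_card_nsmul _ _ _ fun p hp => ?_
    have h2 := List.toFinset_card_le (p.2.1 ++ p.2.2)
    have h3 := (h.absorber p hp).fst_length
    have h4 := (h.absorber p hp).snd_length
    rw [List.length_append] at h2
    refine le_trans (Finset.card_le_card fun v hv => ?_) (h2.trans (by omega))
    simpa using hv
  have h2 : #{v | Δ ≤ #{p ∈ 𝒜 | v ∈ p.2.1 ++ p.2.2}} * Δ ≤ ∑ v, #{p ∈ 𝒜 | v ∈ p.2.1 ++ p.2.2} :=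
    (Finset.card_nsmul_le_sum _ _ Δ fun v hv => (Finset.mem_filter.1 hv).2).trans
      (Finset.sum_le_sum_of_subset (Finset.subset_univ _))
  have h3 := Nat.mul_le_mul_right (2 * L) h.card_le_mul
  refine Nat.le_of_mul_le_mul_left ?_ hΔ
  nlinarith

/-- The vertices that a new absorber at x must avoid outside its centre: those at full load and
those of earlier absorbers at x. -/
lemma exists_forbidden (h : IsAbsorberSystem T S R L k Δ 𝒜) {z : ℕ} (hΔ : 0 < Δ)
    (hz : 2 * L * k * Fintype.card V ≤ Δ * z) (x : V) (hx : #{p ∈ 𝒜 | p.1 = x} < k) :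
    ∃ Z : Finset V, #Z ≤ z + k * (2 * L) ∧
      (∀ v, Δ ≤ #{p ∈ 𝒜 | v ∈ p.2.1 ++ p.2.2} → v ∈ Z) ∧
      ∀ p ∈ 𝒜, p.1 = x → ∀ v ∈ p.2.1 ++ p.2.2, v ∈ Z := by
  refine ⟨({v | Δ ≤ #{p ∈ 𝒜 | v ∈ p.2.1 ++ p.2.2}} : Finset V) ∪
    {p ∈ 𝒜 | p.1 = x}.biUnion (fun p => (p.2.1 ++ p.2.2).toFinset), ?_, ?_, ?_⟩
  · refine (Finset.card_union_le _ _).trans (Nat.add_le_add (h.card_overloaded_le hΔ hz) ?_)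
    refine (Finset.card_biUnion_le_card_mul _ _ (2 * L) fun p hp => ?_).trans
      (Nat.mul_le_mul_right _ hx.le)
    have h2 := List.toFinset_card_le (p.2.1 ++ p.2.2)
    have h3 := (h.absorber p (Finset.mem_filter.1 hp).1).fst_length
    have h4 := (h.absorber p (Finset.mem_filter.1 hp).1).snd_length
    rw [List.length_append] at h2
    omega
  · exact fun v hv => Finset.mem_union_left _ (by simpa using hv)
  · intro p hp hpx v hv
    refine Finset.mem_union_right _ (Finset.mem_biUnion.2 ⟨p, ?_, ?_⟩)
    · simp [hp, hpx]
    · simpa using hv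

lemma insert_absorber (h : IsAbsorberSystem T S R L k Δ 𝒜) (hSR : Disjoint S R) {x : V} {α β : List V}
    (habs : IsAbsorber S R L (x, α, β)) (hx : #{p ∈ 𝒜 | p.1 = x} < k) {Z : Finset V}
    (hZ1 : ∀ v, Δ ≤ #{p ∈ 𝒜 | v ∈ p.2.1 ++ p.2.2} → v ∈ Z)
    (hZ2 : ∀ p ∈ 𝒜, p.1 = x → ∀ v ∈ p.2.1 ++ p.2.2, v ∈ Z)
    (hmem : ∀ e ∈ arcs (α ++ x :: β), T.Adj e.1 e.2 ∧ e ∉ arcsOf (absorberPaths 𝒜))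
    (hnotZ : ∀ v ∈ α ++ β, v ∉ Z) :
    ∃ p ∉ 𝒜, IsAbsorberSystem T S R L k Δ (insert p 𝒜) := by
  have hsep : ∀ q ∈ 𝒜, q.1 = x → ∀ v ∈ α ++ β, v ∉ q.2.1 ++ q.2.2 :=
    fun q hq hqx v hv hvq => hnotZ v hv (hZ2 q hq hqx v hvq)
  have hnew : (x, α, β) ∉ 𝒜 := by
    intro hmem
    have hlen := habs.two_le_length hSR
    obtain ⟨v, hv⟩ : ∃ v, v ∈ α ++ β := by
      refine List.exists_mem_of_ne_nil _ fun hnil => ?_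
      simp at hnil
      simp [hnil.1, hnil.2] at hlen
    exact hsep _ hmem rfl v hv hv
  refine ⟨(x, α, β), hnew, ?_, ?_, ?_, ?_, ?_⟩
  · intro p hp
    rcases Finset.mem_insert.1 hp with rfl | hp
    · exact habs
    · exact h.absorber p hp
  · intro p hp q hq hpq hne v hv hv'
    rcases Finset.mem_insert.1 hp with rfl | hp <;> rcases Finset.mem_insert.1 hq with rfl | hq
    · exact hne rfl
    · exact hsep q hq hpq.symm v hv hv'
    · exact hsep p hp hpq v hv' hv
    · exact h.disjoint p hp q hq hpq hne v hv hv'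
  · rw [absorberPaths_insert hnew, arcsOf_cons]
    refine (Multiset.le_iff_subset ?_).2 ?_
    · rw [Multiset.nodup_add]
      refine ⟨by simpa using nodup_arcs habs.nodup,
        Multiset.nodup_of_le h.arcs_le (arcFinset T).nodup, ?_⟩
      rw [Multiset.disjoint_left]
      intro e he
      exact (hmem e (by simpa using he)).2
    · intro e he
      rcases Multiset.mem_add.1 he with he | he
      · exact mem_arcFinset.2 (hmem e (by simpa using he)).1
      · exact Multiset.mem_of_le h.arcs_le he
  · intro v
    rw [Finset.filter_insert]
    split_ifs with hv
    · simp only at hv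
      subst hv
      exact (Finset.card_insert_le _ _).trans hx
    · exact h.card_le v
  · intro v
    rw [Finset.filter_insert]
    split_ifs with hv
    · refine (Finset.card_insert_le _ _).trans ?_
      by_contra! hlt
      exact hnotZ v hv (hZ1 v (by omega))
    · exact h.load_le v

/-- An absorber system with fewer than `k` absorbers at some centre can be enlarged. -/
lemma exists_insert (h : IsAbsorberSystem T S R L k Δ 𝒜) (hT : IsTournament T)
    (hSR : Disjoint S R) {t z : ℕ} (hΔ : 0 < Δ) (hz : 2 * L * k * Fintype.card V ≤ Δ * z)
    (hL : Fintype.card V ≤ 2 ^ L)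
    (hS : ∀ v ∉ S, outCount (arcFinset T).val v ≤ inCount (arcFinset T).val v + t)
    (hR : ∀ v ∉ R, inCount (arcFinset T).val v ≤ outCount (arcFinset T).val v + t)
    (hSc : t + 2 * (Δ + k) + 2 * (z + k * (2 * L) + L) + 1 < #S)
    (hRc : t + 2 * (Δ + k) + 2 * (z + k * (2 * L) + L) + 1 < #R)
    (x : V) (hx : #{p ∈ 𝒜 | p.1 = x} < k) :
    ∃ p ∉ 𝒜, IsAbsorberSystem T S R L k Δ (insert p 𝒜) := by
  simp only [outCount_finset, inCount_finset] at hS hR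
  have htot : ∀ u v, u ≠ v → (u, v) ∈ arcFinset T ∨ (v, u) ∈ arcFinset T := fun u v huv => by
    simpa using (hT.2 u v huv).or
  obtain ⟨Z, hZ, hZ1, hZ2⟩ := h.exists_forbidden hΔ hz x hx
  obtain ⟨α, hα1, hα2, hα3, hα4, hα5, hαZ⟩ := exists_connector
    (A := fun w u => (w, u) ∈ arcFinset T) (D := Δ + k) (z := z + k * (2 * L)) htot S Z x hS
    (U := fun w u => (w, u) ∈ arcsOf (absorberPaths 𝒜)) h.card_in_le hZ hL (by omega)
  have hZα : #(Z ∪ α.toFinset) ≤ z + k * (2 * L) + L :=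
    (Finset.card_union_le _ _).trans (Nat.add_le_add hZ ((List.toFinset_card_le α).trans hα2))
  -- The second half is a connector from R in the reversed tournament, also avoiding α, and is then
  -- read backwards.
  obtain ⟨β, hβ1, hβ2, hβ3, hβ4, hβ5, hβZ⟩ := exists_connector
    (A := fun w u => (u, w) ∈ arcFinset T) (D := Δ + k) (z := z + k * (2 * L) + L)
    (U := fun w u => (u, w) ∈ arcsOf (absorberPaths 𝒜)) (fun u v huv => (htot u v huv).symm) R
    (Z ∪ α.toFinset) x hR h.card_out_le hZα hL hRc
  have hrev : x :: β.reverse = (β ++ [x]).reverse := by simp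
  replace hβ5 : (x :: β.reverse).IsChain (fun w u => (w, u) ∈ arcFinset T ∧
      ¬ (w, u) ∈ arcsOf (absorberPaths 𝒜)) := by
    rw [hrev, List.isChain_reverse]
    exact hβ5
  replace hβ1 : (x :: β.reverse).Nodup := by
    rw [hrev, List.nodup_reverse]
    exact hβ1
  replace hβ4 : x ∉ R → ∃ a ∈ R, β.reverse.getLast? = some a := by simpa using hβ4
  replace hβ3 : x ∈ R → β.reverse = [] := by simpa using hβ3
  replace hβ2 : β.reverse.length ≤ L := by simpa using hβ2
  replace hβZ : ∀ v ∈ β.reverse, v ∉ Z ∪ α.toFinset := by simpa using hβZ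
  clear hrev
  generalize β.reverse = β at *
  have habs : IsAbsorber S R L (x, α, β) := by
    refine ⟨?_, hα3, hα4, hβ3, hβ4, hα2, hβ2⟩
    simp only
    rw [List.nodup_append] at hα1 ⊢
    refine ⟨hα1.1, hβ1, ?_⟩
    rintro a ha b hb rfl
    rcases List.mem_cons.1 hb with rfl | hb
    · exact hα1.2.2 a ha a (by simp) rfl
    · exact hβZ a hb (Finset.mem_union_right _ (by simpa using ha))
  refine h.insert_absorber hSR habs hx hZ1 hZ2 (fun e he => ?_) (fun v hv => ?_)
  · rw [arcs_append, List.mem_append] at he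
    rcases he with he | he
    · simpa using isChain_iff_arcs.1 hα5 e he
    · simpa using isChain_iff_arcs.1 hβ5 e he
  · rcases List.mem_append.1 hv with hv | hv
    · exact hαZ v hv
    · exact fun h => hβZ v hv (Finset.mem_union_left _ h)

end IsAbsorberSystem

/-- Insertion continues up to nk absorbers; with at most k per centre, each centre then has exactly
k. -/
theorem exists_isAbsorberSystem (T : Digraph V) (hT : IsTournament T) {S R : Finset V}
    (hSR : Disjoint S R) {L k Δ t z : ℕ} (hΔ : 0 < Δ)
    (hz : 2 * L * k * Fintype.card V ≤ Δ * z) (hL : Fintype.card V ≤ 2 ^ L)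
    (hS : ∀ v ∉ S, outCount (arcFinset T).val v ≤ inCount (arcFinset T).val v + t)
    (hR : ∀ v ∉ R, inCount (arcFinset T).val v ≤ outCount (arcFinset T).val v + t)
    (hSc : t + 2 * (Δ + k) + 2 * (z + k * (2 * L) + L) + 1 < #S)
    (hRc : t + 2 * (Δ + k) + 2 * (z + k * (2 * L) + L) + 1 < #R) :
    ∃ 𝒜, IsAbsorberSystem T S R L k Δ 𝒜 ∧ ∀ x, #{p ∈ 𝒜 | p.1 = x} = k := by
  have key : ∀ m ≤ Fintype.card V * k, ∃ 𝒜, IsAbsorberSystem T S R L k Δ 𝒜 ∧ #𝒜 = m := by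
    intro m
    induction m with
    | zero =>
      exact fun _ => ⟨∅, ⟨by simp, by simp, by simp [absorberPaths], by simp, by simp⟩, rfl⟩
    | succ m ih =>
      intro hm
      obtain ⟨𝒜, h𝒜, hcard⟩ := ih (by omega)
      obtain ⟨x, hx⟩ : ∃ x, #{p ∈ 𝒜 | p.1 = x} < k := by
        by_contra! hcon
        have h1 := Finset.card_nsmul_le_sum Finset.univ (fun x => #{p ∈ 𝒜 | p.1 = x}) k
          fun x _ => hcon x
        rw [← Finset.card_eq_sum_card_fiberwise (fun _ _ => by simp), hcard] at h1
        simp at h1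
        omega
      obtain ⟨p, hp, hins⟩ := h𝒜.exists_insert hT hSR hΔ hz hL hS hR hSc hRc x hx
      exact ⟨_, hins, by rw [Finset.card_insert_of_notMem hp, hcard]⟩
  obtain ⟨𝒜, h𝒜, hcard⟩ := key _ le_rfl
  refine ⟨𝒜, h𝒜, fun x => ?_⟩
  have h1 : ∑ x, #{p ∈ 𝒜 | p.1 = x} = ∑ _x : V, k := by
    rw [← Finset.card_eq_sum_card_fiberwise (fun _ _ => by simp), hcard]
    simp
  exact (Finset.sum_eq_sum_iff_of_le fun x _ => h𝒜.card_le x).1 h1 x (Finset.mem_univ x)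

end System

end PathDecomp

/-! ### Assembling the decomposition. -/

namespace PathDecomp

open Finset

section Main

variable {V : Type u} [Fintype V] [DecidableEq V]

lemma outCount_val_le (E : Finset (V × V)) (v : V) : outCount E.val v ≤ Fintype.card V := by
  rw [outCount_finset]
  exact Finset.card_le_univ _

lemma inCount_val_le (E : Finset (V × V)) (v : V) : inCount E.val v ≤ Fintype.card V := by
  rw [inCount_finset]
  exact Finset.card_le_univ _

lemma sum_outCount_eq_sum_inCount (E : Finset (V × V)) :
    ∑ v, outCount E.val v = ∑ v, inCount E.val v := by
  simp only [outCount_finset, inCount_finset]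
  exact Finset.sum_card_bipartiteAbove_eq_sum_card_bipartiteBelow (fun v w => (v, w) ∈ E)

/-- A vertex contributes at most n, and less than t if its excess is below a positive t; large total
excess thus forces many vertices of large excess. -/
lemma excess_le_mul_card_out (D : Digraph V) (t : ℕ) :
    excess D ≤ Fintype.card V *
      (#{v | inCount (arcFinset D).val v + t ≤ outCount (arcFinset D).val v} + t) := by
  have h : ∀ v, (excessAt D v).toNat ≤ (if inCount (arcFinset D).val v + t ≤
      outCount (arcFinset D).val v then Fintype.card V else 0) + t := by
    intro v
    have := outCount_val_le (arcFinset D) v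
    rw [excessAt, outdeg_eq, indeg_eq]
    split_ifs <;> omega
  rw [excess]
  refine (Finset.sum_le_sum fun v _ => h v).trans_eq ?_
  rw [Finset.sum_add_distrib, ← Finset.sum_filter, Finset.sum_const, Finset.sum_const,
    Finset.card_univ, smul_eq_mul, smul_eq_mul]
  ring

lemma excess_le_mul_card_in (D : Digraph V) (t : ℕ) :
    excess D ≤ Fintype.card V *
      (#{v | outCount (arcFinset D).val v + t ≤ inCount (arcFinset D).val v} + t) := by
  have h : ∀ v, (-excessAt D v).toNat ≤ (if outCount (arcFinset D).val v + t ≤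
      inCount (arcFinset D).val v then Fintype.card V else 0) + t := by
    intro v
    have := inCount_val_le (arcFinset D) v
    rw [excessAt, outdeg_eq, indeg_eq]
    split_ifs <;> omega
  -- All excesses sum to zero.
  have h0 : excess D = ∑ v, (-excessAt D v).toNat := by
    have h1 : ∑ v, excessAt D v = 0 := by
      simp only [excessAt, outdeg_eq, indeg_eq, Finset.sum_sub_distrib]
      have := sum_outCount_eq_sum_inCount (arcFinset D)
      push_cast [← Nat.cast_sum] at this ⊢
      omega
    have h2 : ∑ v, (((excessAt D v).toNat : ℤ) - ((-excessAt D v).toNat : ℤ)) = 0 := by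
      rw [← h1]
      refine Finset.sum_congr rfl fun v _ => by omega
    rw [Finset.sum_sub_distrib] at h2
    rw [excess]
    have h3 := sub_eq_zero.1 h2
    exact_mod_cast h3
  rw [h0]
  refine (Finset.sum_le_sum fun v _ => h v).trans_eq ?_
  rw [Finset.sum_add_distrib, ← Finset.sum_filter, Finset.sum_const, Finset.sum_const,
    Finset.card_univ, smul_eq_mul, smul_eq_mul]
  ring

/-- Almost equidistributed colours give the bounds needed for decomposing along differences. -/
lemma exists_colouring_bounds {p : ℕ} [Fact p.Prime] (E : Finset (V × V)) {τ c : ℕ}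
    (hτ : τ ≤ 2 * Fintype.card V) (hc : Fintype.card V + p * τ ≤ p * c)
    (hexp : 4 * (Fintype.card V : ℝ) * p < Real.exp ((τ : ℝ) ^ 2 / (4 * Fintype.card V))) :
    ∃ f : V → ZMod p,
      (∀ v, inCount E.val v ≤ outCount E.val v →
        ∀ i j, inColour E f v i ≤ outColour E f v j + 2 * τ) ∧
      (∀ v, outCount E.val v ≤ inCount E.val v →
        ∀ i j, outColour E f v i ≤ inColour E f v j + 2 * τ) ∧
      (∀ v i, inColour E f v i ≤ c) ∧ (∀ v i, outColour E f v i ≤ c) := by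
  -- Two neighbourhoods per vertex give 2n sets, hence the factor 4np in `hexp`.
  let W : V × Bool → Finset V := fun j =>
    if j.2 then ({w | (j.1, w) ∈ E} : Finset V) else ({w | (w, j.1) ∈ E} : Finset V)
  obtain ⟨f, hf⟩ := exists_balanced_colouring (ι := ZMod p) W (τ : ℝ) (by positivity)
    (by exact_mod_cast hτ) (by
      rw [ZMod.card, Fintype.card_prod, Fintype.card_bool]
      push_cast
      linarith)
  have hp : (0 : ℝ) < p := by exact_mod_cast (Fact.out : p.Prime).pos
  have hout : ∀ v i, |(outColour E f v i : ℝ) - (outCount E.val v : ℝ) / p| ≤ τ := by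
    intro v i
    have := hf (v, true) i
    simp only [colourDeviation, W, if_true, Finset.filter_filter, ZMod.card] at this
    rw [outCount_finset, outColour]
    exact this
  have hin : ∀ v i, |(inColour E f v i : ℝ) - (inCount E.val v : ℝ) / p| ≤ τ := by
    intro v i
    have := hf (v, false) i
    simp only [colourDeviation, W, if_false, Finset.filter_filter, ZMod.card,
      Bool.false_eq_true] at this
    rw [inCount_finset, inColour]
    exact this
  have hc' : ∀ m ≤ Fintype.card V, (m : ℝ) / p + τ ≤ c := by
    intro m hm
    have h1 : (m : ℝ) ≤ Fintype.card V := by exact_mod_cast hm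
    have h2 : (Fintype.card V : ℝ) + p * τ ≤ p * c := by exact_mod_cast hc
    rw [div_add' _ _ _ hp.ne', div_le_iff₀ hp]
    linarith
  refine ⟨f, fun v hv i j => ?_, fun v hv i j => ?_, fun v i => ?_, fun v i => ?_⟩
  · have h1 := (abs_le.1 (hin v i)).2
    have h2 := (abs_le.1 (hout v j)).1
    have h3 : (inCount E.val v : ℝ) / p ≤ (outCount E.val v : ℝ) / p := by gcongr
    have h4 : (inColour E f v i : ℝ) ≤ outColour E f v j + 2 * τ := by linarith
    exact_mod_cast h4
  · have h1 := (abs_le.1 (hout v i)).2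
    have h2 := (abs_le.1 (hin v j)).1
    have h3 : (outCount E.val v : ℝ) / p ≤ (inCount E.val v : ℝ) / p := by gcongr
    have h4 : (outColour E f v i : ℝ) ≤ inColour E f v j + 2 * τ := by linarith
    exact_mod_cast h4
  · have h1 := (abs_le.1 (hin v i)).2
    have h2 := hc' _ (inCount_val_le E v)
    have h4 : (inColour E f v i : ℝ) ≤ c := by linarith
    exact_mod_cast h4
  · have h1 := (abs_le.1 (hout v i)).2
    have h2 := hc' _ (outCount_val_le E v)
    have h4 : (outColour E f v i : ℝ) ≤ c := by linarith
    exact_mod_cast h4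

/-- A tournament has a perfect decomposition if there are suitable parameters. -/
theorem hasPerfectDecomposition_of_parameters (T : Digraph V) (hT : IsTournament T) {p : ℕ}
    [Fact p.Prime] (hp2 : p ≠ 2) {L k Δ t z τ c : ℕ} (hΔ : 0 < Δ) (hkt : Δ + k < t)
    (hz : 2 * L * k * Fintype.card V ≤ Δ * z) (hL : Fintype.card V ≤ 2 ^ L)
    (hex : Fintype.card V * (2 * t + 2 * (Δ + k) + 2 * (z + k * (2 * L) + L) + 1) < excess T)
    (hτ : τ ≤ 2 * Fintype.card V) (hc : Fintype.card V + p * τ ≤ p * c)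
    (hexp : 4 * (Fintype.card V : ℝ) * p < Real.exp ((τ : ℝ) ^ 2 / (4 * Fintype.card V)))
    (hk : p * (2 * τ) + 3 * c + 2 * (p + 2 * L) ≤ k) :
    HasPerfectDecomposition T := by
  set E := arcFinset T with hE
  set S : Finset V := {v | inCount E.val v + t ≤ outCount E.val v} with hSdef
  set R : Finset V := {v | outCount E.val v + t ≤ inCount E.val v} with hRdef
  have hmemS : ∀ v, v ∈ S ↔ inCount E.val v + t ≤ outCount E.val v := fun v => by simp [hSdef]
  have hmemR : ∀ v, v ∈ R ↔ outCount E.val v + t ≤ inCount E.val v := fun v => by simp [hRdef]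
  have hSR : Disjoint S R := Finset.disjoint_left.2 fun v h1 h2 => by
    rw [hmemS] at h1
    rw [hmemR] at h2
    omega
  have hSc := Nat.lt_of_mul_lt_mul_left (hex.trans_le (excess_le_mul_card_out T t))
  have hRc := Nat.lt_of_mul_lt_mul_left (hex.trans_le (excess_le_mul_card_in T t))
  obtain ⟨𝒜, h𝒜, hcard⟩ := exists_isAbsorberSystem T hT hSR (L := L) (k := k) (t := t) hΔ hz hL
    (fun v hv => by rw [hmemS] at hv; rw [← hE]; omega)
    (fun v hv => by rw [hmemR] at hv; rw [← hE]; omega)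
    (by simp only [← hE, ← hSdef] at hSc; omega) (by simp only [← hE, ← hRdef] at hRc; omega)
  set B := absorberPaths 𝒜 with hB
  set F := E \ (arcsOf B).toFinset with hF
  have hEF : E.val = F.val + arcsOf B := by
    rw [hF, Finset.sdiff_val, Multiset.toFinset_val,
      (Multiset.nodup_of_le h𝒜.arcs_le E.nodup).dedup, tsub_add_cancel_of_le h𝒜.arcs_le]
  obtain ⟨f, hf1, hf2, hf3, hf4⟩ := exists_colouring_bounds (p := p) F hτ hc hexp
  obtain ⟨Q, hQ1, hQ2, hQ3, hQ4⟩ := exists_family_of_colouring hp2 F f (2 * τ) c hf1 hf2 (by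
    rintro ⟨a, b⟩ he hab
    obtain rfl : a = b := hab
    have := (Finset.mem_sdiff.1 he).1
    rw [hE, mem_arcFinset] at this
    exact hT.1 _ this) hf3 hf4
  have hout : ∀ v, outCount E.val v = outCount F.val v + outCount (arcsOf B) v := fun v => by
    rw [hEF, outCount_add]
  have hin : ∀ v, inCount E.val v = inCount F.val v + inCount (arcsOf B) v := fun v => by
    rw [hEF, inCount_add]
  have hbalB := outCount_arcsOf_add_endsAt B
  have hbalQ := outCount_arcsOf_add_endsAt Q
  rw [hQ1] at hbalQ
  have hstartB : ∀ v ∉ S, startsAt B v = 0 := by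
    intro v hv
    by_contra h
    obtain ⟨l, hl, hlv⟩ := startsAt_pos.1 (Nat.pos_of_ne_zero h)
    obtain ⟨q, hq, rfl⟩ := Multiset.mem_map.1 hl
    obtain ⟨a, ha, ha'⟩ := (h𝒜.absorber q hq).head_mem
    rw [ha', Option.some.injEq] at hlv
    exact hv (hlv ▸ ha)
  have hendB : ∀ v ∉ R, endsAt B v = 0 := by
    intro v hv
    by_contra h
    obtain ⟨l, hl, hlv⟩ := endsAt_pos.1 (Nat.pos_of_ne_zero h)
    obtain ⟨q, hq, rfl⟩ := Multiset.mem_map.1 hl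
    obtain ⟨a, ha, ha'⟩ := (h𝒜.absorber q hq).last_mem
    rw [ha', Option.some.injEq] at hlv
    exact hv (hlv ▸ ha)
  have hstartB' : ∀ v, startsAt B v ≤ Δ + k := by
    intro v
    refine le_trans ?_ (h𝒜.countP_mem_le v)
    rw [startsAt, Multiset.countP_eq_card_filter, Multiset.countP_eq_card_filter]
    exact Multiset.card_le_card (Multiset.monotone_filter_right _ fun l hl =>
      List.mem_of_mem_head? hl)
  have hendB' : ∀ v, endsAt B v ≤ Δ + k := by
    intro v
    refine le_trans ?_ (h𝒜.countP_mem_le v)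
    rw [endsAt, Multiset.countP_eq_card_filter, Multiset.countP_eq_card_filter]
    exact Multiset.card_le_card (Multiset.monotone_filter_right _ fun l hl =>
      List.mem_of_mem_getLast? hl)
  have hRS : ∀ v ∈ S, v ∉ R := fun v h1 h2 => Finset.disjoint_left.1 hSR h1 h2
  have hSR' : ∀ v ∈ R, v ∉ S := fun v h1 h2 => Finset.disjoint_left.1 hSR h2 h1
  -- Paths of `Q` have at most p vertices and may gain L at each end.
  obtain ⟨P, hP1, hP2, hP3⟩ := exists_family_of_absorbers hSR L (p + 2 * L) (#𝒜) Q 𝒜 rfl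
    (by
      intro l hl
      obtain ⟨h1, h2, h3⟩ := hQ2 l hl
      refine ⟨h1, h2, ?_⟩
      rw [potential]
      split_ifs <;> omega)
    h𝒜.absorber h𝒜.disjoint
    (by
      intro v hv
      -- At v ∈ S no absorber ends and at most Δ + k < t start, so some path of `Q` must start at v.
      have h1 := hendB v (hRS v hv)
      have h2 := hstartB' v
      have h3 := (hmemS v).1 hv
      have h4 := hout v
      have h5 := hin v
      have h6 := hbalB v
      have h7 := hbalQ v
      omega)
    (by
      intro v hv
      have h1 := hstartB v (hSR' v hv)
      have h2 := hendB' v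
      have h3 := (hmemR v).1 hv
      have h4 := hout v
      have h5 := hin v
      have h6 := hbalB v
      have h7 := hbalQ v
      omega)
    (by
      intro v
      -- No vertex is both a start and an end of absorbers, and removing them keeps the sign of the
      -- excess on S and R. So the conflicts are bounded by those of `Q`.
      rw [hcard v, startsAt_add, endsAt_add, ← hB]
      have h4 := hout v
      have h5 := hin v
      have h6 := hbalB v
      have h8 := hQ3 v
      have h9 := hQ4 v
      by_cases hvS : v ∈ S
      · have h1 := hendB v (hRS v hvS)
        have h2 := hstartB' v
        have h3 := (hmemS v).1 hvS
        have h10 := h8 (by omega)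
        omega
      · have h1 := hstartB v hvS
        by_cases hvR : v ∈ R
        · have h2 := hendB' v
          have h3 := (hmemR v).1 hvR
          have h10 := h9 (by omega)
          omega
        · have h2 := hendB v hvR
          rcases le_total (inCount F.val v) (outCount F.val v) with h | h
          · have h10 := h8 h
            omega
          · have h10 := h9 h
            omega)
  refine hasPerfectDecomposition_of_family T P hP2 ?_ hP3
  rw [hP1, arcsOf_add, hQ1, ← hB, ← hEF]

end Main

/-! ### Choice of parameters. -/

section Numerics

lemma pow_mul_le_two_pow {ℓ : ℕ} (h : 200 ≤ ℓ) : 2 ^ 160 * (144 * (ℓ + 1)) ≤ 2 ^ ℓ := by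
  induction ℓ, h using Nat.le_induction with
  | base => norm_num
  | succ m hm ih =>
    rw [pow_succ 2 m]
    omega

theorem hasPerfectDecomposition_of_excess {V : Type u} [Fintype V] (T : Digraph V)
    (hT : IsTournament T) {ℓ : ℕ} (hℓ : 200 ≤ ℓ) (hn1 : 2 ^ (144 * ℓ) ≤ Fintype.card V)
    (hn2 : Fintype.card V ≤ 2 ^ (144 * (ℓ + 1)))
    (hex : 8 * (Fintype.card V * 2 ^ (128 * ℓ)) ≤ excess T) : HasPerfectDecomposition T := by
  classical
  set n := Fintype.card V with hn
  obtain ⟨q, hq⟩ : ∃ q, q = 2 ^ ℓ := ⟨_, rfl⟩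
  obtain ⟨L, hLdef⟩ : ∃ L, L = 144 * (ℓ + 1) := ⟨_, rfl⟩
  obtain ⟨C, hC⟩ : ∃ C, C = 2 ^ 144 := ⟨_, rfl⟩
  have hqL : 2 ^ 160 * L ≤ q := by rw [hq, hLdef]; exact pow_mul_le_two_pow hℓ
  have hLn : n ≤ 2 ^ L := by rw [hLdef]; exact hn2
  have hpow : ∀ m, 2 ^ (m * ℓ) = q ^ m := fun m => by rw [hq, ← pow_mul, mul_comm]
  rw [hpow] at hn1 hex
  have hn3 : n ≤ C * q ^ 144 := by
    rw [hC, ← hpow, ← pow_add]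
    exact hn2.trans_eq (by ring_nf)
  have hL1 : 1 ≤ L := by omega
  have hCq : 2 ^ 16 * C * L ≤ q := by
    rw [hC]
    linarith
  have hC1 : 1 ≤ C := by rw [hC]; exact Nat.one_le_two_pow
  have hCL : C ≤ C * L := Nat.le_mul_of_pos_right C hL1
  have hLC : L ≤ C * L := Nat.le_mul_of_pos_left L hC1
  have hCLq : 2 ^ 16 * (C * L) ≤ q := by rwa [← mul_assoc]
  have hq1 : 1 ≤ q := by omega
  have hmono : ∀ {a b : ℕ}, a ≤ b → q ^ a ≤ q ^ b := fun h => Nat.pow_le_pow_right hq1 h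
  have hn0 : 0 < n := (Nat.pow_pos hq1).trans_le hn1
  obtain ⟨p, hp, hpq, hp2q⟩ := Nat.exists_prime_lt_and_le_two_mul (q ^ 36) (Nat.pow_pos hq1).ne'
  have : Fact p.Prime := ⟨hp⟩
  have hqp : q ≤ q ^ 36 := by simpa using hmono (a := 1) (b := 36) (by norm_num)
  -- Here n ≈ q^144 up to the factor C, and p ≈ q^36. So τ is just above √n, k just above pτ and
  -- n/p, Δ and z share the product kn ≈ q^254 evenly, and t exceeds both. Each spare power of q
  -- absorbs C, L and constants.
  refine hasPerfectDecomposition_of_parameters T hT (p := p) (by omega) (L := L) (k := q ^ 110)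
    (Δ := q ^ 127) (t := q ^ 128) (z := 2 * (C * L) * q ^ 127) (τ := q ^ 73)
    (c := C * q ^ 108 + q ^ 73) (Nat.pow_pos hq1) ?_ ?_ hLn ?_ ?_ ?_ ?_ ?_
  · have h1 := hmono (a := 110) (b := 127) (by norm_num)
    have h2 : 0 < q ^ 127 := Nat.pow_pos hq1
    have h3 : 3 * q ^ 127 ≤ q * q ^ 127 := Nat.mul_le_mul_right _ (by omega)
    rw [pow_succ' q 127]
    omega
  · calc 2 * L * q ^ 110 * n ≤ 2 * L * q ^ 110 * (C * q ^ 144) := Nat.mul_le_mul_left _ hn3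
      _ = q ^ 127 * (2 * (C * L) * q ^ 127) := by ring
  · refine lt_of_lt_of_le ?_ hex
    rw [mul_left_comm 8]
    refine Nat.mul_lt_mul_of_pos_left ?_ hn0
    have h1 := hmono (a := 110) (b := 127) (by norm_num)
    have h2 : 0 < q ^ 127 := Nat.pow_pos hq1
    have h3 : 2 ^ 16 * (C * L) * q ^ 127 ≤ q * q ^ 127 := Nat.mul_le_mul_right _ hCLq
    have h4 : q ^ 110 * (2 * L) ≤ 2 * (C * L * q ^ 127) := by
      calc q ^ 110 * (2 * L) ≤ q ^ 127 * (2 * (C * L)) :=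
            Nat.mul_le_mul h1 (Nat.mul_le_mul_left 2 hLC)
        _ = 2 * (C * L * q ^ 127) := by ring
    have h5 : q ^ 127 ≤ C * L * q ^ 127 := Nat.le_mul_of_pos_left _ (by omega)
    have h6 : L ≤ C * L * q ^ 127 := hLC.trans (Nat.le_mul_of_pos_right _ h2)
    rw [pow_succ' q 127]
    rw [mul_assoc] at h3
    rw [mul_assoc 2 (C * L)]
    omega
  · have := hmono (a := 73) (b := 144) (by norm_num)
    omega
  · have h1 : C * q ^ 144 ≤ p * (C * q ^ 108) := by
      calc C * q ^ 144 = q ^ 36 * (C * q ^ 108) := by ring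
        _ ≤ _ := Nat.mul_le_mul_right _ hpq.le
    rw [mul_add]
    omega
  · have h1 : 4 * n * p ≤ 2 ^ (2 * L) := by
      have h2 : 4 * p ≤ n := by
        have h3 : 8 * q ^ 36 ≤ q ^ 144 := by
          calc 8 * q ^ 36 ≤ q * q ^ 36 := Nat.mul_le_mul_right _ (by omega)
            _ = q ^ 37 := by ring
            _ ≤ q ^ 144 := hmono (by norm_num)
        omega
      calc 4 * n * p = (4 * p) * n := by ring
        _ ≤ 2 ^ L * 2 ^ L := Nat.mul_le_mul (h2.trans hLn) hLn
        _ = 2 ^ (2 * L) := by ring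
    have h2 : 2 * L * (4 * n) ≤ (q ^ 73) ^ 2 := by
      calc 2 * L * (4 * n) ≤ 2 * L * (4 * (C * q ^ 144)) := by gcongr
        _ = 8 * (C * L) * q ^ 144 := by ring
        _ ≤ q * q ^ 144 := Nat.mul_le_mul_right _ (by omega)
        _ = q ^ 145 := by ring
        _ ≤ q ^ 146 := hmono (by norm_num)
        _ = _ := by ring
    have h3 : (2 : ℝ) ^ (2 * L) < Real.exp 1 ^ (2 * L) :=
      pow_lt_pow_left₀ (by linarith [Real.exp_one_gt_d9]) (by norm_num) (by omega)
    have h4 : (4 : ℝ) * n * p ≤ 2 ^ (2 * L) := by exact_mod_cast h1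
    refine (h4.trans_lt h3).trans_le ?_
    rw [← Real.exp_nat_mul, mul_one]
    refine Real.exp_le_exp.2 ?_
    rw [le_div_iff₀ (mul_pos four_pos (Nat.cast_pos.2 hn0))]
    exact_mod_cast h2
  · have h1 : 3 * C * q ^ 108 ≤ q ^ 109 := by
      rw [pow_succ' q 108]
      exact Nat.mul_le_mul_right _ (by omega)
    have h2 := hmono (a := 73) (b := 109) (by norm_num)
    have h3 := hmono (a := 36) (b := 109) (by norm_num)
    have h4 : p * (2 * q ^ 73) ≤ 4 * q ^ 109 := by
      calc p * (2 * q ^ 73) ≤ 2 * q ^ 36 * (2 * q ^ 73) := Nat.mul_le_mul_right _ hp2q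
        _ = 4 * q ^ 109 := by ring
    have h5 : 16 * q ^ 109 ≤ q * q ^ 109 := Nat.mul_le_mul_right _ (by omega)
    rw [pow_succ' q 109]
    rw [mul_assoc] at h1
    omega

end Numerics

end PathDecomp

/-! ### Real exponents and the final theorem. -/

namespace PathDecomp

theorem hasPerfectDecomposition_of_le_excess {V : Type u} [Fintype V] (T : Digraph V)
    (hT : IsTournament T) {m : ℕ} (hm : 144 * 200 ≤ m) (hn : 2 ^ m ≤ Fintype.card V)
    (hex : 8 * (Fintype.card V : ℝ) ^ (17 / 9 : ℝ) ≤ excess T) : HasPerfectDecomposition T := by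
  set n := Fintype.card V with hndef
  have hn0 : n ≠ 0 := by
    have : 0 < 2 ^ m := Nat.pow_pos (by norm_num)
    omega
  have h1 : 144 * 200 ≤ Nat.log 2 n := hm.trans (Nat.le_log_of_pow_le (by norm_num) hn)
  have h2 : 2 ^ (144 * (Nat.log 2 n / 144)) ≤ n :=
    (Nat.pow_le_pow_right (by norm_num) (Nat.mul_div_le _ _)).trans (Nat.pow_log_le_self 2 hn0)
  -- With this ℓ, 2^(128ℓ) ≤ n^(128/144) = n^(8/9).
  refine hasPerfectDecomposition_of_excess T hT (ℓ := Nat.log 2 n / 144) (by omega) h2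
    ((Nat.lt_pow_succ_log_self (by norm_num) n).le.trans
      (Nat.pow_le_pow_right (by norm_num) (by omega))) ?_
  set ℓ := Nat.log 2 n / 144
  have hnpos : (0 : ℝ) < n := by exact_mod_cast Nat.pos_of_ne_zero hn0
  have h3 : ((2 : ℝ) ^ (128 * ℓ)) ≤ (n : ℝ) ^ (8 / 9 : ℝ) := by
    have h4 : ((2 : ℝ) ^ (144 * ℓ)) ≤ n := by exact_mod_cast h2
    calc ((2 : ℝ) ^ (128 * ℓ)) = ((2 : ℝ) ^ (144 * ℓ)) ^ (8 / 9 : ℝ) := by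
          rw [← Real.rpow_natCast, ← Real.rpow_natCast, ← Real.rpow_mul (by norm_num)]
          congr 1
          push_cast
          ring
      _ ≤ _ := Real.rpow_le_rpow (by positivity) h4 (by norm_num)
  have h5 : (n : ℝ) * 2 ^ (128 * ℓ) ≤ (n : ℝ) ^ (17 / 9 : ℝ) := by
    calc (n : ℝ) * 2 ^ (128 * ℓ) ≤ n * (n : ℝ) ^ (8 / 9 : ℝ) := by gcongr
      _ = (n : ℝ) ^ (1 + 8 / 9 : ℝ) := by rw [Real.rpow_add hnpos, Real.rpow_one]
      _ = _ := by norm_num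
  have h6 : (8 * (n * 2 ^ (128 * ℓ) : ℕ) : ℝ) ≤ excess T := by
    push_cast
    linarith
  exact_mod_cast h6

end PathDecomp

theorem mainTheorem2 :
    (∀ γ : ℝ, 0 < γ → ∃ n₀ : ℕ, ∀ (V : Type u) [Fintype V] (T : Digraph V),
      PathDecomp.IsTournament T → n₀ ≤ Fintype.card V →
      8 * (Fintype.card V : ℝ) ^ ((17 / 9 : ℝ) + γ) ≤ (PathDecomp.excess T : ℝ) →
      PathDecomp.HasPerfectDecomposition T) ∧
    (∃ n₀ : ℕ, ∀ (V : Type u) [Fintype V] (T : Digraph V),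
      PathDecomp.IsTournament T → n₀ < Fintype.card V → Even (Fintype.card V) →
      (Fintype.card V : ℝ) ^ ((2 : ℝ) - 1 / 18) ≤ (PathDecomp.excess T : ℝ) →
      PathDecomp.pathNumber T = PathDecomp.excess T) := by
  obtain ⟨m, hm⟩ : ∃ m, 144 * 200 ≤ m := ⟨_, le_rfl⟩
  have hone : ∀ n : ℕ, 2 ^ m ≤ n → (1 : ℝ) ≤ n := fun n hn => by
    exact_mod_cast (Nat.one_le_two_pow).trans hn
  refine ⟨fun γ hγ => ⟨2 ^ m, fun V _ T hT hn hex => ?_⟩,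
    2 ^ m, fun V _ T hT hn _ hex => ?_⟩
  · refine PathDecomp.hasPerfectDecomposition_of_le_excess T hT hm hn (le_trans ?_ hex)
    have := Real.rpow_le_rpow_of_exponent_le (hone _ hn) (by linarith : (17 / 9 : ℝ) ≤ 17 / 9 + γ)
    linarith
  · classical
    refine PathDecomp.pathNumber_eq_excess hT.1
      (PathDecomp.hasPerfectDecomposition_of_le_excess T hT hm hn.le (le_trans ?_ hex))
    have h1 := hone _ hn.le
    -- Since 2 - 1/18 = 17/9 + 1/18, the spare factor n^(1/18) pays for the constant 8.
    have h2 : (8 : ℝ) ≤ (Fintype.card V : ℝ) ^ (1 / 18 : ℝ) := by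
      have h3 : ((8 : ℝ) ^ 18) ≤ Fintype.card V := by
        have h4 : 8 ^ 18 ≤ 2 ^ m :=
          (show 8 ^ 18 = 2 ^ 54 by norm_num).trans_le (Nat.pow_le_pow_right two_pos (by omega))
        exact_mod_cast h4.trans hn.le
      calc (8 : ℝ) = ((8 : ℝ) ^ 18) ^ (1 / 18 : ℝ) := by
            rw [← Real.rpow_natCast, ← Real.rpow_mul (by norm_num)]
            norm_num
        _ ≤ _ := Real.rpow_le_rpow (by positivity) h3 (by norm_num)
    calc 8 * (Fintype.card V : ℝ) ^ (17 / 9 : ℝ)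
        ≤ (Fintype.card V : ℝ) ^ (1 / 18 : ℝ) * (Fintype.card V : ℝ) ^ (17 / 9 : ℝ) := by gcongr
      _ = (Fintype.card V : ℝ) ^ ((2 : ℝ) - 1 / 18) := by
        rw [← Real.rpow_add (by linarith)]
        norm_num
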